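/- Corollary 5.6. All graphs are undirected, finite, and without loops or multiple edges. A 3-edge-colouring of a graph assigns one of three given colours to each edge so that no two adjacent edges receive the same colour. A snark is a connected cubic graph of girth at least $5$ that has no 3-edge-colouring and is cyclically 4-edge-connected, i.e. for every set $S$ of at most three edges of $G$, no two cycles of $G-S$ lie in different components of $G-S$. For an edge $e=(u,v)$ of a snark $G$, let $u_1,u_2$ be the neighbours of $u$ other than $v$, and $v_1,v_2$ the neighbours of $v$ other than $u$. Let $G_e$ be the cubic graph obtained from $G$ by deleting $u$, $v$ and all edges at them and adding the new edges $(u_1,u_2)$ and $(v_1,v_2)$. The number of 3-edge-colourings of $G_e$ is divisible by $18$, and $\psi(G,e)$ denotes the nonnegative integer such that $G_e$ has exactly $18\cdot\psi(G,e)$ 3-edge-colourings. Let $i,j,k,l$ be nonnegative integers. Then there exist a snark $G$ and an edge $e$ of $G$ such that $$\psi(G,e)=2^i\cdot 3^j\cdot 5^k\cdot 7^l .$$ -/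

import Mathlib

/-- A (proper) 3-edge-colouring of `G`: an assignment of one of three colours to each edge so that
no two distinct edges sharing an endpoint get the same colour. -/
abbrev ThreeEdgeColouring {V : Type*} (G : SimpleGraph V) : Type _ :=
  G.lineGraph.Coloring (Fin 3)

/-- `G` is cyclically `k`-edge-connected: no set `S` of fewer than `k` edges of `G` has the property
that two cycles of `G - S` lie in different connected components of `G - S`. (Two cycles in
different components are automatically vertex-disjoint, and conversely a set of edges that separates
two disjoint cycles `A`, `B` of `G` from each other is a set `S` such that `A` and `B` are contained
in different components of `G - S`.) -/
def CyclicallyEdgeConnected {V : Type*} (G : SimpleGraph V) (k : ℕ) : Prop :=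
  ∀ S : Set (Sym2 V), S ⊆ G.edgeSet → S.encard < k →
    ∀ (a b : V) (p : (G.deleteEdges S).Walk a a) (q : (G.deleteEdges S).Walk b b),
      p.IsCycle → q.IsCycle → (G.deleteEdges S).Reachable a b

/-- A snark: a finite connected cubic graph without loops or multiple edges, of girth at least 5,
cyclically 4-edge-connected, and not 3-edge-colourable. -/
structure IsSnark {V : Type*} (G : SimpleGraph V) : Prop where
  finite : Finite V
  connected : G.Connected
  cubic : ∀ v : V, (G.neighborSet v).ncard = 3
  five_le_girth : 5 ≤ G.egirth
  cyclically_four_edge_connected : CyclicallyEdgeConnected G 4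
  not_three_edge_colourable : IsEmpty (ThreeEdgeColouring G)

/-- Edge subtraction `G_e`, for an edge `e = (u, v)` of a cubic graph: the vertices `u`, `v` and all
edges at them are deleted, the two remaining neighbours `u₁, u₂` of `u` are joined by a new edge, and
so are the two remaining neighbours `v₁, v₂` of `v`. Since a snark has girth at least 5, the two new
edges are not loops, differ from each other, and are not parallel to old edges, so the result is
again a simple graph. -/
def edgeSubtract {V : Type*} (G : SimpleGraph V) (e : Sym2 V) : SimpleGraph {w : V // w ∉ e} where
  Adj x y := G.Adj x y ∨ (x ≠ y ∧ ∃ u ∈ e, G.Adj u x ∧ G.Adj u y)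
  symm := ⟨fun _ _ h => h.imp (fun h => h.symm)
    (fun ⟨hne, u, hu, hx, hy⟩ => ⟨hne.symm, u, hu, hy, hx⟩)⟩
  loopless := ⟨fun _ h => h.elim (fun h => h.ne rfl) (fun h => h.1 rfl)⟩

/-- The number of 3-edge-colourings of `G_e`. -/
noncomputable def numColourings {V : Type*} (G : SimpleGraph V) (e : Sym2 V) : ℕ :=
  Nat.card (ThreeEdgeColouring (edgeSubtract G e))

/-- `ψ(G, e)`, the number `J` such that `G_e` has exactly `18 * J` 3-edge-colourings. -/
noncomputable def psi {V : Type*} (G : SimpleGraph V) (e : Sym2 V) : ℕ :=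
  numColourings G e / 18

/-! Call a cubic piece with four dangling edges edge-like of multiplicity `m` if it admits exactly
the boundary colourings that an edge with two dangling edges at either end admits, each of them in
`m` ways. Replacing an edge of a cubic graph, together with its two ends, by such a piece multiplies
the number of 3-edge-colourings by `m`; in particular, an uncolourable graph stays uncolourable.

Edge-like pieces come from snarks. Cut two edges of a snark, so that four dangling edges arise. By
the parity lemma, a colouring of what remains either gives equal colours to the two halves of each
cut edge, which would colour the snark, or shows the boundary pattern of an edge. Colour
permutations and a Kempe switch show that all these patterns occur equally often. The Petersen
graph, two cuts in Blanuša snarks and the flower snark on 20 vertices provide the multiplicities 2,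
5, 7 and 9; the formal proof obtains these counts by enumeration. If another edge of the cut snark
is replaced by an edge-like piece, the multiplicities multiply (`EdgeLike.glue`), so that every `2 ^
i * 9 ^ a * 5 ^ k * 7 ^ l` occurs.

Finally such a piece replaces an edge of the Petersen graph or of a Blanuša snark, and a different
edge `e` of that snark is subtracted. Before the replacement, the subtracted graph has 18 or 18 · 3
colourings, so the result has 18 times the multiplicity of the piece, or 18 · 3 times it
(`EdgeLike.exists_isSnark`). The choice between 1 and 3 accounts for the parity of the exponent of
3.

It remains to see that the graphs are snarks. Short cycles through the junction are excluded by
distances in the socket. For cyclic connectivity a stronger statement is carried along: every edge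
cut with at least two vertices on both sides has at least four edges (`NoSmallCuts`). It survives
replacement because any cut of the piece can be traded for a cut of the replaced edge that is no
larger (`PairLikeCuts`). -/

/-- A multipole with vertices `V`, edges `E` and dangling edges `T`. -/
structure Pole (V E T : Type) where
  src : E → V
  dst : E → V
  ter : T → V

/-! ### Poles, their colourings and gluing -/

namespace Pole

variable {V E T W F I : Type}

/-- Incidence of an edge or dangling edge with a vertex. -/
def Inc (P : Pole V E T) : E ⊕ T → V → Prop
  | .inl e, v => P.src e = v ∨ P.dst e = v
  | .inr i, v => P.ter i = v

/-- `f`, `t` colour the edges and the dangling edges so that those meeting at a vertex get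
different colours. -/
def Proper (P : Pole V E T) (f : E → Fin 3) (t : T → Fin 3) : Prop :=
  ∀ v x y, P.Inc x v → P.Inc y v → x ≠ y → Sum.elim f t x ≠ Sum.elim f t y

/-- The number of proper colourings with given colours of the dangling edges. -/
noncomputable def count (P : Pole V E T) (t : T → Fin 3) : ℕ :=
  Nat.card {f : E → Fin 3 // P.Proper f t}

/-- Join the dangling edges of `D` to those dangling edges of `B` that are indexed by `I`. -/
def glue (D : Pole V E I) (B : Pole W F (I ⊕ T)) : Pole (V ⊕ W) (E ⊕ F ⊕ I) T where
  src := Sum.elim (Sum.inl ∘ D.src) (Sum.elim (Sum.inr ∘ B.src) (Sum.inl ∘ D.ter))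
  dst := Sum.elim (Sum.inl ∘ D.dst) (Sum.elim (Sum.inr ∘ B.dst) (Sum.inr ∘ B.ter ∘ Sum.inl))
  ter := Sum.inr ∘ B.ter ∘ Sum.inr

theorem glue_proper (D : Pole V E I) (B : Pole W F (I ⊕ T)) (f : E → Fin 3) (g : F → Fin 3)
    (t : I → Fin 3) (t' : T → Fin 3) :
    (D.glue B).Proper (Sum.elim f (Sum.elim g t)) t' ↔
      D.Proper f t ∧ B.Proper g (Sum.elim t t') := by
  simp only [Proper, glue, Inc, Sum.forall, Sum.elim_inl, Sum.elim_inr, Function.comp_apply,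
    Sum.inl.injEq, Sum.inr.injEq, reduceCtorEq, or_self, false_imp_iff, imp_true_iff, and_true,
    true_and, ne_eq, not_false_eq_true, forall_true_left, forall_and]
  grind

/-- Once the colours of the junction edges are fixed, the two sides are coloured independently. -/
theorem glue_count [Finite E] [Finite F] [Fintype I] [DecidableEq I] (D : Pole V E I)
    (B : Pole W F (I ⊕ T)) (t' : T → Fin 3) :
    (D.glue B).count t' = ∑ t : I → Fin 3, D.count t * B.count (Sum.elim t t') := by
  have e : {f : E ⊕ F ⊕ I → Fin 3 // (D.glue B).Proper f t'} ≃
      (Σ t : I → Fin 3, {f : E → Fin 3 // D.Proper f t} ×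
        {g : F → Fin 3 // B.Proper g (Sum.elim t t')}) :=
    { toFun := fun f => ⟨fun i => f.1 (.inr (.inr i)),
        ⟨fun e => f.1 (.inl e), ((glue_proper D B (fun e => f.1 (.inl e))
          (fun e => f.1 (.inr (.inl e))) _ t').1 (by
            have := f.2
            convert this using 1
            ext x; rcases x with x | x | x <;> rfl)).1⟩,
        ⟨fun e => f.1 (.inr (.inl e)), ((glue_proper D B (fun e => f.1 (.inl e))
          (fun e => f.1 (.inr (.inl e))) _ t').1 (by
            have := f.2
            convert this using 1
            ext x; rcases x with x | x | x <;> rfl)).2⟩⟩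
      invFun := fun p => ⟨Sum.elim p.2.1.1 (Sum.elim p.2.2.1 p.1),
        (glue_proper D B _ _ _ t').2 ⟨p.2.1.2, p.2.2.2⟩⟩
      left_inv := fun f => by
        apply Subtype.ext
        ext x; rcases x with x | x | x <;> rfl
      right_inv := fun p => rfl }
  rw [count, Nat.card_congr e, Nat.card_sigma]
  simp only [Nat.card_prod, count]

/-! ### Cuts -/

/-- `1` if the two sides differ, and `0` otherwise. -/
def sep (a b : Bool) : ℕ := (a ^^ b).toNat

theorem sep_self (b : Bool) : sep b b = 0 := by revert b; decide

theorem sep_not (b : Bool) : sep (!b) b = 1 := by revert b; decide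

/-- The number of edges in the cut given by `X`. -/
def cut [Fintype E] (P : Pole V E T) (X : V → Bool) : ℕ :=
  ∑ e, sep (X (P.src e)) (X (P.dst e))

theorem glue_cut [Fintype E] [Fintype F] [Fintype I] (D : Pole V E I) (B : Pole W F (I ⊕ T))
    (X : V ⊕ W → Bool) :
    (D.glue B).cut X = D.cut (X ∘ Sum.inl) + B.cut (X ∘ Sum.inr) +
      ∑ i, sep (X (.inl (D.ter i))) (X (.inr (B.ter (.inl i)))) := by
  simp [cut, glue, Fintype.sum_sum_type, add_assoc]

/-- At least two points take the value `b`. -/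
def Two (X : V → Bool) (b : Bool) : Prop := ∃ v w, v ≠ w ∧ X v = b ∧ X w = b

/-- The cost of replacing a pole with boundary pattern `τ` by an adjacent pair of vertices on the
sides `p` and `q`. -/
def pairCost (τ : Fin 4 → Bool) (p q : Bool) : ℕ :=
  sep p q + sep p (τ 0) + sep p (τ 1) + sep q (τ 2) + sep q (τ 3)

/-- As far as small cuts are concerned, `D` may replace a pair of adjacent vertices in a
cyclically 4-edge-connected cubic graph. -/
structure PairLikeCuts [Fintype E] (D : Pole V E (Fin 4)) : Prop where
  replace : ∀ X : V → Bool, (∃ v w, X v ≠ X w) → ∀ p,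
    (∃ p' q', (p' ≠ p ∨ q' ≠ p) ∧ pairCost (X ∘ D.ter) p' q' ≤ D.cut X) ∨
      pairCost (X ∘ D.ter) p p + 1 ≤ D.cut X
  three_le : ∀ (X : V → Bool) b, (∃ v, X v = !b) → 3 ≤ D.cut X + ∑ i, sep (X (D.ter i)) b
  four_le : ∀ (X : V → Bool) b, Two X (!b) → 4 ≤ D.cut X + ∑ i, sep (X (D.ter i)) b

/-- `B`, completed by an adjacent pair of vertices at the first four dangling edges, and with the
number `c` of additional edges in a cut, has no small cuts but the trivial ones. -/
structure CompletedCuts [Fintype F] (B : Pole W F (Fin 4 ⊕ T)) (c : (W → Bool) → ℕ) : Prop where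
  const : ∀ b, c (fun _ => b) = 0
  pigeonhole : ∀ Y : W → Bool, ∃ b, Two Y b
  three_le : ∀ (Y : W → Bool) p q, (∃ v w, Y v ≠ Y w) →
    3 ≤ B.cut Y + c Y + pairCost (Y ∘ B.ter ∘ Sum.inl) p q
  four_le : ∀ (Y : W → Bool) b p q, Two Y b → (∃ v, Y v = !b) → (p ≠ b ∨ q ≠ b) →
    4 ≤ B.cut Y + c Y + pairCost (Y ∘ B.ter ∘ Sum.inl) p q
  four_le' : ∀ (Y : W → Bool) b, Two Y (!b) →
    4 ≤ B.cut Y + c Y + pairCost (Y ∘ B.ter ∘ Sum.inl) b b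

/-- A graph with edge cuts of size `k X` has no small cuts but the trivial ones. -/
structure NoSmallCuts (k : (V → Bool) → ℕ) : Prop where
  three_le : ∀ X, (∃ v w, X v ≠ X w) → 3 ≤ k X
  four_le : ∀ X, Two X true → Two X false → 4 ≤ k X

/-- Triangle inequality along each of the four junction edges: `τ` stands for their ends in the
piece and `σ` for their ends in the socket. -/
theorem pairCost_le_add (τ σ : Fin 4 → Bool) (p q : Bool) :
    pairCost σ p q + sep p q ≤ pairCost τ p q + sep p q + ∑ i, sep (τ i) (σ i) := by
  simp only [pairCost, Fin.sum_univ_four]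
  generalize τ 0 = a, τ 1 = b, τ 2 = c, τ 3 = d, σ 0 = a', σ 1 = b', σ 2 = c', σ 3 = d'
  have key : ∀ p a a', sep p a' ≤ sep p a + sep a a' := by decide
  have := key p a a'; have := key p b b'; have := key q c c'; have := key q d d'
  omega

/-- A cut of the glued graph is compared with a cut of the completed socket, in which the piece has
been traded for an adjacent pair according to `PairLikeCuts.replace`. Cuts that are constant on one
side of the junction are treated separately. -/
theorem glue_noSmallCuts [Fintype E] [Fintype F] {D : Pole V E (Fin 4)}
    {B : Pole W F (Fin 4 ⊕ T)} {c : (W → Bool) → ℕ} (hD : D.PairLikeCuts)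
    (hB : B.CompletedCuts c) :
    NoSmallCuts fun X : V ⊕ W → Bool => (D.glue B).cut X + c (X ∘ Sum.inr) := by
  have const_right : ∀ (X : V ⊕ W → Bool) b, (∀ w, X (.inr w) = b) →
      (D.glue B).cut X + c (X ∘ Sum.inr) =
        D.cut (X ∘ Sum.inl) + ∑ i, sep ((X ∘ Sum.inl) (D.ter i)) b := by
    intro X b h
    have h' : X ∘ Sum.inr = fun _ => b := funext h
    rw [glue_cut, h', hB.const]
    simp [cut, h, sep_self]
  -- Whenever a pair on the sides `p`, `q` costs at most `D.cut`, this bounds the cut of the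
  -- completed socket by the cut of the glued graph.
  have expand : ∀ (X : V ⊕ W → Bool) p q,
      B.cut (X ∘ Sum.inr) + c (X ∘ Sum.inr) +
        pairCost ((X ∘ Sum.inr) ∘ B.ter ∘ Sum.inl) p q + D.cut (X ∘ Sum.inl) ≤
      (D.glue B).cut X + c (X ∘ Sum.inr) + pairCost ((X ∘ Sum.inl) ∘ D.ter) p q := by
    intro X p q
    have := pairCost_le_add ((X ∘ Sum.inl) ∘ D.ter) ((X ∘ Sum.inr) ∘ B.ter ∘ Sum.inl) p q
    rw [glue_cut]
    simp only [Function.comp_apply] at this ⊢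
    omega
  have left_const : ∀ (X : V ⊕ W → Bool) b, (∀ v, X (.inl v) = b) →
      B.cut (X ∘ Sum.inr) + c (X ∘ Sum.inr) +
        pairCost ((X ∘ Sum.inr) ∘ B.ter ∘ Sum.inl) b b ≤
      (D.glue B).cut X + c (X ∘ Sum.inr) := by
    intro X b h
    have := expand X b b
    have h0 : pairCost ((X ∘ Sum.inl) ∘ D.ter) b b = 0 := by
      simp only [pairCost, Function.comp_apply, h, sep_self]
    omega
  refine ⟨fun X hX => ?_, fun X h1 h2 => ?_⟩
  · by_cases hY : ∃ v w, X (.inr v) ≠ X (.inr w)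
    · by_cases hX' : ∃ v w, X (.inl v) ≠ X (.inl w)
      · rcases hD.replace (X ∘ Sum.inl) hX' true with ⟨p, q, -, h⟩ | h
        · have := hB.three_le (X ∘ Sum.inr) p q hY
          have := expand X p q
          omega
        · have := hB.three_le (X ∘ Sum.inr) true true hY
          have := expand X true true
          omega
      · push Not at hX'
        obtain ⟨b, hb⟩ : ∃ b, ∀ v, X (.inl v) = b := by
          by_cases hV : Nonempty V
          · exact ⟨X (.inl hV.some), fun v => hX' _ _⟩
          · exact ⟨true, fun v => (hV ⟨v⟩).elim⟩
        have := hB.three_le (X ∘ Sum.inr) b b hY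
        have := left_const X b hb
        omega
    · push Not at hY
      obtain ⟨b, ⟨w, _, _, hw, _⟩⟩ := hB.pigeonhole (X ∘ Sum.inr)
      have hb : ∀ w, X (.inr w) = b := fun w' => (hY _ _).trans hw
      show 3 ≤ (D.glue B).cut X + c (X ∘ Sum.inr)
      rw [const_right X b hb]
      apply hD.three_le
      obtain ⟨v, w, hvw⟩ := hX
      by_contra! hcon
      have : ∀ v, X v = b := by
        rintro (v | v)
        · simpa using hcon v
        · exact hb v
      exact hvw (by rw [this, this])
  · have two : ∀ b, Two X b := by rintro (_ | _) <;> assumption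
    by_cases hY : ∃ v w, X (.inr v) ≠ X (.inr w)
    · by_cases hX' : ∃ v w, X (.inl v) ≠ X (.inl w)
      -- Take `b` to be a side with two socket vertices. Either the pair contributes a vertex to the
      -- other side, so that both sides have two vertices, or it lies wholly on side `b` and the
      -- edge saved lifts the bound 3 to 4.
      · obtain ⟨b, hb⟩ := hB.pigeonhole (X ∘ Sum.inr)
        have hb' : ∃ v, (X ∘ Sum.inr) v = !b := by
          obtain ⟨v, w, h⟩ := hY
          by_contra! hcon
          simp only [ne_eq, Bool.not_eq_not, Function.comp_apply] at hcon
          exact h (by rw [hcon, hcon])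
        rcases hD.replace (X ∘ Sum.inl) hX' b with ⟨p, q, hpq, h⟩ | h
        · have := hB.four_le (X ∘ Sum.inr) b p q hb hb' hpq
          have := expand X p q
          omega
        · have := hB.three_le (X ∘ Sum.inr) b b hY
          have := expand X b b
          omega
      · push Not at hX'
        obtain ⟨b, hb⟩ : ∃ b, ∀ v, X (.inl v) = b := by
          by_cases hV : Nonempty V
          · exact ⟨X (.inl hV.some), fun v => hX' _ _⟩
          · exact ⟨true, fun v => (hV ⟨v⟩).elim⟩
        refine (hB.four_le' (X ∘ Sum.inr) b ?_).trans (left_const X b hb)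
        obtain ⟨v, w, hvw, hv, hw⟩ := two (!b)
        rcases v with v | v
        · simp [hb] at hv
        rcases w with w | w
        · simp [hb] at hw
        exact ⟨v, w, fun h => hvw (by rw [h]), hv, hw⟩
    · push Not at hY
      obtain ⟨b, ⟨w, _, _, hw, _⟩⟩ := hB.pigeonhole (X ∘ Sum.inr)
      have hb : ∀ w, X (.inr w) = b := fun w' => (hY _ _).trans hw
      show 4 ≤ (D.glue B).cut X + c (X ∘ Sum.inr)
      rw [const_right X b hb]
      apply hD.four_le
      obtain ⟨v, w, hvw, hv, hw⟩ := two (!b)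
      rcases v with v | v
      · rcases w with w | w
        · exact ⟨v, w, fun h => hvw (by rw [h]), hv, hw⟩
        · simp [hb] at hw
      · simp [hb] at hv

/-- The number of edges in a cut among two edges joining the first two and the last two dangling
ends. -/
def closingCut (τ : Fin 4 → Bool) : ℕ := sep (τ 0) (τ 1) + sep (τ 2) (τ 3)

/-- Closing the piece by two edges gives a graph without small cuts, and at most two edges of a cut
are lost when these are removed again. The remaining slack suffices in each distribution of the four
ends. -/
theorem NoSmallCuts.pairLikeCuts [Fintype E] {D : Pole V E (Fin 4)}
    (hinj : Function.Injective D.ter)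
    (h : NoSmallCuts fun X => D.cut X + closingCut (X ∘ D.ter)) : D.PairLikeCuts := by
  have ne : ∀ i j : Fin 4, i ≠ j → D.ter i ≠ D.ter j := fun i j hij h => hij (hinj h)
  have key3 : ∀ (X : V → Bool) b, (∃ v, X v = !b) →
      3 ≤ D.cut X + ∑ i, sep (X (D.ter i)) b := by
    intro X b hX
    by_cases hc : ∃ v, X v = b
    · obtain ⟨v, hv⟩ := hX
      obtain ⟨w, hw⟩ := hc
      have := h.three_le X ⟨v, w, by simp [hv, hw]⟩
      have aux : ∀ (a₀ a₁ a₂ a₃ b : Bool), sep a₀ a₁ + sep a₂ a₃ ≤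
        sep a₀ b + sep a₁ b + sep a₂ b + sep a₃ b := by decide
      have := aux (X (D.ter 0)) (X (D.ter 1)) (X (D.ter 2)) (X (D.ter 3)) b
      simp only [closingCut, Function.comp_apply, Fin.sum_univ_four] at *
      omega
    · have hc' : ∀ v, X v = !b := by simpa [← Bool.not_eq] using hc
      simp [hc', sep_not]
  refine ⟨fun X hX p => ?_, key3, ?_⟩
  -- If no closing edge is cut, put each vertex of the pair on the side of its two ends; if one is
  -- cut, put both on the side of the uncut one. If both are cut, any two equal sides cost 2, and
  -- `four_le` gives `D.cut X ≥ 2`.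
  · have h3 := h.three_le X hX
    have h4 : (X (D.ter 0) ≠ X (D.ter 1) ∧ X (D.ter 2) ≠ X (D.ter 3)) →
        4 ≤ D.cut X + closingCut (X ∘ D.ter) := by
      rintro ⟨h01, h23⟩
      have aux : ∀ a b c : Bool, a ≠ b → a ≠ c → b = c := by decide
      have two : ∀ b, Two X b := by
        intro b
        obtain ⟨i, hi, hi'⟩ : ∃ i : Fin 4, i < 2 ∧ X (D.ter i) = b := by
          by_cases h0 : X (D.ter 0) = b
          · exact ⟨0, by decide, h0⟩
          · exact ⟨1, by decide, aux _ _ _ h01 h0⟩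
        obtain ⟨j, hj, hj'⟩ : ∃ i : Fin 4, 2 ≤ i ∧ X (D.ter i) = b := by
          by_cases h0 : X (D.ter 2) = b
          · exact ⟨2, by decide, h0⟩
          · exact ⟨3, by decide, aux _ _ _ h23 h0⟩
        exact ⟨_, _, ne i j (by omega), hi', hj'⟩
      exact h.four_le X (two _) (two _)
    simp only [closingCut, pairCost, Function.comp_apply] at *
    generalize D.cut X = k at *
    generalize X (D.ter 0) = a₀, X (D.ter 1) = a₁, X (D.ter 2) = a₂, X (D.ter 3) = a₃ at *
    cases a₀ <;> cases a₁ <;> cases a₂ <;> cases a₃ <;> cases p <;>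
      simp [sep] at * <;> omega
  · intro X b hX
    by_cases hc : Two X b
    · have h4 : 4 ≤ D.cut X + closingCut (X ∘ D.ter) := by
        apply h.four_le X <;> cases b <;> assumption
      have aux : ∀ (a₀ a₁ a₂ a₃ b : Bool), sep a₀ a₁ + sep a₂ a₃ ≤
        sep a₀ b + sep a₁ b + sep a₂ b + sep a₃ b := by decide
      have := aux (X (D.ter 0)) (X (D.ter 1)) (X (D.ter 2)) (X (D.ter 3)) b
      simp only [closingCut, Function.comp_apply, Fin.sum_univ_four] at *
      omega
    · by_cases hc' : ∃ v, X v = b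
      -- Exactly one vertex is on side `b`; as the ends are distinct, at most one of them is there.
      · obtain ⟨v, hv⟩ := hc'
        have huniq : ∀ i j, i ≠ j → ¬ (X (D.ter i) = b ∧ X (D.ter j) = b) :=
          fun i j hij hh => hc ⟨_, _, ne i j hij, hh.1, hh.2⟩
        obtain ⟨w, _, _, hw, _⟩ := hX
        have h3 := h.three_le X ⟨v, w, by simp [hv, hw]⟩
        have h01 := huniq 0 1 (by decide)
        have h02 := huniq 0 2 (by decide)
        have h03 := huniq 0 3 (by decide)
        have h12 := huniq 1 2 (by decide)
        have h13 := huniq 1 3 (by decide)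
        have h23 := huniq 2 3 (by decide)
        simp only [closingCut, Function.comp_apply, Fin.sum_univ_four] at *
        clear huniq hc hv hw
        generalize D.cut X = k at *
        generalize X (D.ter 0) = a₀, X (D.ter 1) = a₁, X (D.ter 2) = a₂, X (D.ter 3) = a₃ at *
        revert h01 h02 h03 h12 h13 h23 h3
        clear h ne key3
        cases a₀ <;> cases a₁ <;> cases a₂ <;> cases a₃ <;> cases b <;>
          simp [sep] <;> omega
      · have hc'' : ∀ v, X v = !b := by simpa [← Bool.not_eq] using hc'
        simp [hc'', sep_not]

/-! ### Adjacency and short cycles -/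

/-- Adjacency of vertices. -/
def Adj (P : Pole V E T) (v w : V) : Prop :=
  ∃ e, (P.src e = v ∧ P.dst e = w) ∨ (P.src e = w ∧ P.dst e = v)

theorem Adj.symm {P : Pole V E T} {v w : V} (h : P.Adj v w) : P.Adj w v :=
  h.imp fun _ h => h.symm

/-- There are no loops and no multiple edges. -/
structure Simple (P : Pole V E T) : Prop where
  loopless : ∀ e, P.src e ≠ P.dst e
  inj : ∀ e e', P.src e = P.src e' → P.dst e = P.dst e' → e = e'
  inj' : ∀ e e', P.src e = P.dst e' → P.dst e ≠ P.src e'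

/-- There are no cycles of length at most four. -/
structure GirthFive (P : Pole V E T) : Prop extends P.Simple where
  triangle : ∀ u v w, P.Adj u v → P.Adj v w → ¬ P.Adj w u
  square : ∀ u v w x, P.Adj u w → P.Adj w v → P.Adj v x → P.Adj x u → u = v ∨ w = x

/-- The first dangling edges of `B` are far from each other, as is the case when they come from
the deletion of two adjacent vertices in a graph without short cycles. -/
structure Spread (B : Pole W F (Fin 4 ⊕ T)) : Prop where
  inj : ∀ i j, B.ter (.inl i) = B.ter (.inl j) → i = j
  not_adj : ∀ i j, ¬ B.Adj (B.ter (.inl i)) (B.ter (.inl j))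
  far : ∀ i j : Fin 4, i ≠ j → (i : ℕ) / 2 = j / 2 → ∀ w,
    B.Adj (B.ter (.inl i)) w → ¬ B.Adj w (B.ter (.inl j))

/-- Dangling edges that belong to different pairs have different ends. -/
def Paired (D : Pole V E (Fin 4)) : Prop :=
  ∀ i j : Fin 4, D.ter i = D.ter j → (i : ℕ) / 2 = j / 2

section glue

variable (D : Pole V E I) (B : Pole W F (I ⊕ T))

@[simp] theorem glue_adj_inl_inl (v w : V) : (D.glue B).Adj (.inl v) (.inl w) ↔ D.Adj v w := by
  simp [Adj, glue, Sum.exists]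

@[simp] theorem glue_adj_inr_inr (v w : W) : (D.glue B).Adj (.inr v) (.inr w) ↔ B.Adj v w := by
  simp [Adj, glue, Sum.exists]

@[simp] theorem glue_adj_inl_inr (v : V) (w : W) :
    (D.glue B).Adj (.inl v) (.inr w) ↔ ∃ i, D.ter i = v ∧ B.ter (.inl i) = w := by
  simp [Adj, glue, Sum.exists]

@[simp] theorem glue_adj_inr_inl (v : V) (w : W) :
    (D.glue B).Adj (.inr w) (.inl v) ↔ ∃ i, D.ter i = v ∧ B.ter (.inl i) = w := by
  simp [Adj, glue, Sum.exists]

end glue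

theorem Simple.glue {D : Pole V E (Fin 4)} {B : Pole W F (Fin 4 ⊕ T)} (hD : D.Simple)
    (hB : B.Simple) (hS : ∀ i j, B.ter (.inl i) = B.ter (.inl j) → i = j) :
    (D.glue B).Simple where
  loopless := by
    rintro (e | e | e) h
    · exact hD.loopless e (Sum.inl.inj h)
    · exact hB.loopless e (Sum.inr.inj h)
    · cases h
  inj := by
    rintro (e | e | e) (e' | e' | e') h h' <;> simp [Pole.glue] at h h' ⊢
    · exact hD.inj e e' h h'
    · exact hB.inj e e' h h'
    · exact hS _ _ h'
  inj' := by
    rintro (e | e | e) (e' | e' | e') h h' <;> simp [Pole.glue] at h h'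
    · exact hD.inj' e e' h h'
    · exact hB.inj' e e' h h'

/-- A new cycle uses at least two junction edges. Their ends in the socket are distinct and not
adjacent, so length at most four forces a common end in `D` and a common neighbour in `B`; the
former makes the two edges a pair by `Paired`, and `far` then excludes the latter. -/
theorem GirthFive.glue {D : Pole V E (Fin 4)} {B : Pole W F (Fin 4 ⊕ T)} (hD : D.GirthFive)
    (hB : B.GirthFive) (hp : D.Paired) (hS : B.Spread) : (D.glue B).GirthFive where
  toSimple := hD.toSimple.glue hB.toSimple hS.inj
  triangle := by
    have inj := hS.inj
    have not_adj := hS.not_adj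
    have t1 := hD.triangle
    have t2 := hB.triangle
    have l : ∀ v, ¬ D.Adj v v := by
      rintro v ⟨e, h | h⟩ <;> exact hD.loopless e (h.1.trans h.2.symm)
    rintro (u | u) (v | v) (w | w) <;>
      simp only [glue_adj_inl_inl, glue_adj_inr_inr, glue_adj_inl_inr, glue_adj_inr_inl] <;>
      grind
  square := by
    have inj := hS.inj
    have not_adj := hS.not_adj
    have s1 := hD.square
    have s2 := hB.square
    have far : ∀ i j : Fin 4, i ≠ j → D.ter i = D.ter j → ∀ w,
        B.Adj (B.ter (.inl i)) w → ¬ B.Adj w (B.ter (.inl j)) :=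
      fun i j hij h => hS.far i j hij (hp i j h)
    have sy1 : ∀ v w, D.Adj v w → D.Adj w v := fun _ _ h => h.symm
    have sy2 : ∀ v w, B.Adj v w → B.Adj w v := fun _ _ h => h.symm
    rintro (u | u) (v | v) (w | w) (x | x) <;>
      simp only [glue_adj_inl_inl, glue_adj_inr_inr, glue_adj_inl_inr, glue_adj_inr_inl,
        Sum.inl.injEq, Sum.inr.injEq, reduceCtorEq, or_false, false_or] <;>
      grind

/-! ### Degrees -/

/-- The number of edges, including dangling edges, at a vertex. -/
def degree [Fintype E] [Fintype T] [DecidableEq V] (P : Pole V E T) (v : V) : ℕ :=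
  ∑ e, ((if P.src e = v then 1 else 0) + (if P.dst e = v then 1 else 0)) +
    ∑ i, if P.ter i = v then 1 else 0

theorem glue_degree_inl [Fintype E] [Fintype F] [Fintype I] [Fintype T] [DecidableEq V]
    [DecidableEq W] (D : Pole V E I) (B : Pole W F (I ⊕ T)) (v : V) :
    (D.glue B).degree (.inl v) = D.degree v := by
  simp [degree, glue, Fintype.sum_sum_type]

theorem glue_degree_inr [Fintype E] [Fintype F] [Fintype I] [Fintype T] [DecidableEq V]
    [DecidableEq W] (D : Pole V E I) (B : Pole W F (I ⊕ T)) (w : W) :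
    (D.glue B).degree (.inr w) = B.degree w := by
  simp [degree, glue, Fintype.sum_sum_type, add_assoc, -Finset.sum_boole]

/-! ### The graph of a pole without dangling edges -/

/-- The underlying simple graph. -/
def graph (P : Pole V E T) : SimpleGraph V where
  Adj v w := v ≠ w ∧ P.Adj v w
  symm := ⟨fun _ _ h => ⟨h.1.symm, h.2.symm⟩⟩
  loopless := ⟨fun _ h => h.1 rfl⟩

theorem Simple.adj_ne {P : Pole V E T} (h : P.Simple) {v w : V} (hvw : P.Adj v w) : v ≠ w := by
  obtain ⟨e, ⟨rfl, rfl⟩ | ⟨rfl, rfl⟩⟩ := hvw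
  · exact h.loopless e
  · exact (h.loopless e).symm

theorem Simple.graph_adj {P : Pole V E T} (h : P.Simple) {v w : V} :
    P.graph.Adj v w ↔ P.Adj v w :=
  ⟨fun h => h.2, fun hvw => ⟨h.adj_ne hvw, hvw⟩⟩

theorem Simple.ncard_neighborSet [Fintype E] [Fintype T] [IsEmpty T] [DecidableEq V]
    {P : Pole V E T} (h : P.Simple) (v : V) : (P.graph.neighborSet v).ncard = P.degree v := by
  let near : E ⊕ E → V := Sum.elim P.src P.dst
  let far : E ⊕ E → V := Sum.elim P.dst P.src
  have himg : P.graph.neighborSet v = far '' {x | near x = v} := by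
    ext w
    simp only [SimpleGraph.mem_neighborSet, h.graph_adj, Set.mem_image, Set.mem_ofPred_eq,
      Sum.exists, near, far, Adj, Sum.elim_inl, Sum.elim_inr]
    rw [← exists_or]
    exact exists_congr fun e => by tauto
  have hinj : Set.InjOn far {x | near x = v} := by
    rintro (e | e) he (e' | e') he' hee <;> simp only [Set.mem_ofPred_eq, near, far, Sum.elim_inl,
      Sum.elim_inr] at he he' hee
    · rw [h.inj e e' (he.trans he'.symm) hee]
    · exact (h.inj' e e' (he.trans he'.symm) hee).elim
    · exact (h.inj' e e' hee (he.trans he'.symm)).elim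
    · rw [h.inj e e' hee (he.trans he'.symm)]
  rw [himg, hinj.ncard_image, Set.ncard_eq_toFinset_card']
  simp [degree, near, Finset.card_filter, Fintype.sum_sum_type, Finset.sum_add_distrib,
    -Finset.sum_boole]
  congr!

theorem GirthFive.five_le_egirth {P : Pole V E T} (h : P.GirthFive) : 5 ≤ P.graph.egirth := by
  rw [SimpleGraph.le_egirth]
  intro a p hp
  have h3 := hp.three_le_length
  by_contra hlt
  have hlt : p.length < 5 := by exact_mod_cast not_le.1 hlt
  have hnd := hp.support_nodup
  match p with
  | .nil => simp at h3
  | .cons _ .nil => simp at h3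
  | .cons _ (.cons _ .nil) => simp at h3
  | .cons h1 (.cons h2 (.cons h3 .nil)) => exact h.triangle _ _ _ h1.2 h2.2 h3.2
  | .cons h1 (.cons h2 (.cons h3 (.cons h4 .nil))) =>
    simp at hnd
    have := h.square _ _ _ _ h1.2 h2.2 h3.2 h4.2
    grind
  | .cons _ (.cons _ (.cons _ (.cons _ (.cons _ _)))) =>
    simp at hlt
    omega

/-- If `X` is constant along the edges outside `S`, every edge of its cut lies in `S`. -/
theorem Simple.cut_le_encard [Fintype E] {P : Pole V E T} (h : P.Simple) (S : Set (Sym2 V))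
    (X : V → Bool) (hX : ∀ v w, (P.graph.deleteEdges S).Adj v w → X v = X w) :
    (P.cut X : ℕ∞) ≤ S.encard := by
  have hcut : P.cut X = (Finset.univ.filter fun e => X (P.src e) ≠ X (P.dst e)).card := by
    rw [Finset.card_filter]
    refine Finset.sum_congr rfl fun e _ => ?_
    generalize X (P.src e) = a, X (P.dst e) = b
    revert a b
    decide
  rw [hcut, ← Set.encard_coe_eq_coe_finsetCard]
  have hinj : Function.Injective fun e => s(P.src e, P.dst e) := by
    intro e e' hee
    rcases Sym2.eq_iff.1 hee with h' | h'
    · exact h.inj _ _ h'.1 h'.2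
    · exact (h.inj' _ _ h'.1 h'.2).elim
  rw [← hinj.encard_image]
  refine Set.encard_le_encard ?_
  rintro _ ⟨e, he, rfl⟩
  by_contra hS
  have : X (P.src e) ≠ X (P.dst e) := by simpa using he
  refine this (hX _ _ ?_)
  rw [SimpleGraph.deleteEdges_adj]
  exact ⟨h.graph_adj.2 ⟨e, .inl ⟨rfl, rfl⟩⟩, hS⟩

theorem Simple.connected [Fintype E] [Nonempty V] {P : Pole V E T} (h : P.Simple)
    (hP : NoSmallCuts P.cut) : P.graph.Connected := by
  classical
  rw [SimpleGraph.connected_iff]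
  refine ⟨fun a b => ?_, inferInstance⟩
  by_contra hab
  have h3 := hP.three_le (fun v => decide (P.graph.Reachable a v)) ⟨a, b, by simp [hab]⟩
  have := h.cut_le_encard ∅ (fun v => decide (P.graph.Reachable a v)) fun v w hvw => by
    rw [SimpleGraph.deleteEdges_empty] at hvw
    simp only [decide_eq_decide]
    exact ⟨fun h => h.trans hvw.reachable, fun h => h.trans hvw.reachable.symm⟩
  rw [Set.encard_empty, nonpos_iff_eq_zero, Nat.cast_eq_zero] at this
  omega

/-- The component of one cycle is a vertex set whose cut lies in `S`. Two separated cycles put at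
least two vertices on each side of this cut, so `S` has at least four elements. -/
theorem Simple.cyclicallyEdgeConnected [Fintype E] {P : Pole V E T} (h : P.Simple)
    (hP : NoSmallCuts P.cut) : CyclicallyEdgeConnected P.graph 4 := by
  classical
  intro S _ hS a b p q hp hq
  by_contra hab
  have cyc : ∀ (c : V) (p : (P.graph.deleteEdges S).Walk c c), p.IsCycle →
      ∃ d, c ≠ d ∧ (P.graph.deleteEdges S).Reachable c d := fun c p hp => by
    have := p.adj_snd hp.not_nil
    exact ⟨_, this.ne, this.reachable⟩
  obtain ⟨a', ha, ha'⟩ := cyc a p hp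
  obtain ⟨b', hb, hb'⟩ := cyc b q hq
  have h4 := hP.four_le (fun v => decide ((P.graph.deleteEdges S).Reachable a v))
    ⟨a, a', ha, by simp, by simpa using ha'⟩
    ⟨b, b', hb, by simpa using hab, by simpa using fun h => hab (h.trans hb'.symm)⟩
  have := h.cut_le_encard S (fun v => decide ((P.graph.deleteEdges S).Reachable a v))
    fun v w hvw => by
      simp only [decide_eq_decide]
      exact ⟨fun h => h.trans hvw.reachable, fun h => h.trans hvw.reachable.symm⟩
  have h5 := lt_of_le_of_lt this hS
  have h6 := Nat.cast_lt.1 h5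
  omega

theorem Simple.card_threeEdgeColouring [IsEmpty T] {P : Pole V E T} (h : P.Simple)
    (t : T → Fin 3) : Nat.card (ThreeEdgeColouring P.graph) = P.count t := by
  have hinj : Function.Injective fun e => s(P.src e, P.dst e) := by
    intro e e' hee
    rcases Sym2.eq_iff.1 hee with h' | h'
    · exact h.inj _ _ h'.1 h'.2
    · exact (h.inj' _ _ h'.1 h'.2).elim
  have hmem : ∀ e, s(P.src e, P.dst e) ∈ P.graph.edgeSet := fun e => by
    rw [SimpleGraph.mem_edgeSet, h.graph_adj]
    exact ⟨e, .inl ⟨rfl, rfl⟩⟩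
  let φ : E → P.graph.edgeSet := fun e => ⟨s(P.src e, P.dst e), hmem e⟩
  have hφ : Function.Bijective φ := by
    refine ⟨fun e e' hee => hinj (congrArg Subtype.val hee), ?_⟩
    rintro ⟨x, hx⟩
    induction x using Sym2.ind with
    | _ v w =>
      rw [SimpleGraph.mem_edgeSet, h.graph_adj] at hx
      obtain ⟨e, ⟨rfl, rfl⟩ | ⟨rfl, rfl⟩⟩ := hx
      · exact ⟨e, rfl⟩
      · exact ⟨e, Subtype.ext Sym2.eq_swap⟩
  have hadj : ∀ e e', P.graph.lineGraph.Adj (φ e) (φ e') ↔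
      e ≠ e' ∧ ∃ v, P.Inc (.inl e) v ∧ P.Inc (.inl e') v := by
    intro e e'
    rw [SimpleGraph.lineGraph_adj_iff_exists, hφ.1.ne_iff]
    simp [φ, Inc, eq_comm]
  refine Nat.card_congr ?_
  refine
    { toFun := fun c => ⟨fun e => c (φ e), ?_⟩
      invFun := fun f => SimpleGraph.Coloring.mk
        (fun x => f.1 ((Equiv.ofBijective φ hφ).symm x)) ?_
      left_inv := ?_
      right_inv := ?_ }
  · rintro v (x | x) (y | y) hx hy hxy
    · exact c.valid ((hadj x y).2 ⟨fun h => hxy (by rw [h]), v, hx, hy⟩)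
    all_goals exact isEmptyElim ‹T›
  · intro x y hxy
    obtain ⟨e, rfl⟩ := hφ.2 x
    obtain ⟨e', rfl⟩ := hφ.2 y
    obtain ⟨hne, v, hv, hv'⟩ := (hadj e e').1 hxy
    have hs : ∀ e, (Equiv.ofBijective φ hφ).symm (φ e) = e :=
      (Equiv.ofBijective φ hφ).symm_apply_apply
    rw [hs, hs]
    exact f.2 v (.inl e) (.inl e') hv hv' (fun h => hne (Sum.inl.inj h))
  · intro c
    ext x
    have := (Equiv.ofBijective φ hφ).apply_symm_apply x
    exact congrArg (fun y => ((c y : Fin 3) : ℕ)) this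
  · intro f
    ext e
    have := (Equiv.ofBijective φ hφ).symm_apply_apply e
    exact congrArg (fun y => ((f.1 y : Fin 3) : ℕ)) this

theorem GirthFive.isSnark [Finite V] [Nonempty V] [Fintype E] [Fintype T] [IsEmpty T]
    [DecidableEq V] {P : Pole V E T} (h : P.GirthFive) (hdeg : ∀ v, P.degree v = 3)
    (hcut : NoSmallCuts P.cut) {t : T → Fin 3} (hcount : P.count t = 0) : IsSnark P.graph where
  finite := inferInstance
  connected := h.connected hcut
  cubic v := by rw [h.ncard_neighborSet, hdeg]
  five_le_girth := h.five_le_egirth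
  cyclically_four_edge_connected := h.cyclicallyEdgeConnected hcut
  not_three_edge_colourable := by
    have : Finite (ThreeEdgeColouring P.graph) := DFunLike.finite _
    rw [← Finite.card_eq_zero_iff, h.card_threeEdgeColouring t, hcount]

/-! ### Initial segments of sequences, as reversed lists -/

/-- The list `[h (m - 1), ..., h 1, h 0]`. -/
def initial {α : Type} (h : ℕ → α) : ℕ → List α
  | 0 => []
  | m + 1 => h m :: initial h m

theorem length_initial {α : Type} (h : ℕ → α) (m : ℕ) : (initial h m).length = m := by
  induction m with
  | zero => rfl
  | succ m ih => simp [initial, ih]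

theorem getElem?_initial {α : Type} (h : ℕ → α) (m j : ℕ) (hj : j < m) :
    (initial h m)[j]? = some (h (m - 1 - j)) := by
  induction m generalizing j with
  | zero => omega
  | succ m ih =>
    cases j with
    | zero => simp [initial]
    | succ j =>
      simp only [initial, List.getElem?_cons_succ]
      rw [ih j (by omega)]
      congr 2
      omega

theorem initial_congr {α : Type} {h h' : ℕ → α} {m : ℕ} (H : ∀ i < m, h i = h' i) :
    initial h m = initial h' m := by
  induction m with
  | zero => rfl
  | succ m ih => rw [initial, initial, H m (by omega), ih fun i hi => H i (by omega)]

theorem initial_inj {α : Type} {h h' : ℕ → α} {m : ℕ} (H : initial h m = initial h' m) :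
    ∀ i < m, h i = h' i := by
  intro i hi
  have : (initial h m)[m - 1 - i]? = (initial h' m)[m - 1 - i]? := by rw [H]
  rw [getElem?_initial _ _ _ (by omega), getElem?_initial _ _ _ (by omega)] at this
  simpa [show m - 1 - (m - 1 - i) = i by omega] using this

theorem eq_initial {α : Type} [Inhabited α] (l : List α) :
    l = initial (fun i => (l[l.length - 1 - i]?).getD default) l.length := by
  apply List.ext_getElem?
  intro j
  by_cases hj : j < l.length
  · rw [getElem?_initial _ _ _ hj, show l.length - 1 - (l.length - 1 - j) = j by omega,
      List.getElem?_eq_getElem hj]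
    rfl
  · rw [List.getElem?_eq_none (by omega), List.getElem?_eq_none (by rw [length_initial]; omega)]

/-! ### Enumeration of colourings -/

/-- Extend every list in `L` by a colour that differs from those at the positions `bs`. -/
def extend (L : List (List (Fin 3))) (bs : List ℕ) : List (List (Fin 3)) :=
  L.flatMap fun l =>
    ([0, 1, 2].filter fun c => bs.all fun j => decide (l[j]? ≠ some c)).map (· :: l)

theorem cons_mem_extend {L : List (List (Fin 3))} {bs : List ℕ} {c : Fin 3} {l : List (Fin 3)} :
    c :: l ∈ extend L bs ↔ l ∈ L ∧ ∀ j ∈ bs, l[j]? ≠ some c := by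
  have : c = 0 ∨ c = 1 ∨ c = 2 := by revert c; decide
  simp only [extend, List.mem_flatMap, List.mem_map, List.mem_filter, List.all_eq_true,
    decide_eq_true_eq, List.cons.injEq]
  constructor
  · rintro ⟨l', hl', c', ⟨-, h⟩, rfl, rfl⟩
    exact ⟨hl', h⟩
  · rintro ⟨hl, h⟩
    exact ⟨l, hl, c, ⟨by simpa using this, h⟩, rfl, rfl⟩

theorem exists_of_mem_extend {L : List (List (Fin 3))} {bs : List ℕ} {x : List (Fin 3)}
    (h : x ∈ extend L bs) : ∃ c l, x = c :: l ∧ l ∈ L := by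
  simp only [extend, List.mem_flatMap, List.mem_map] at h
  obtain ⟨l, hl, c, -, rfl⟩ := h
  exact ⟨c, l, rfl, hl⟩

theorem nodup_extend {L : List (List (Fin 3))} (hL : L.Nodup) (bs : List ℕ) :
    (extend L bs).Nodup := by
  rw [extend, List.nodup_flatMap]
  refine ⟨fun l _ => ?_, ?_⟩
  · refine List.Nodup.map (fun a b h => (List.cons.inj h).1) (List.Nodup.filter _ (by decide))
  · refine hL.imp fun {l l'} hne => ?_
    rw [Function.onFun, List.disjoint_left]
    intro x hx hx'
    simp only [List.mem_map] at hx hx'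
    obtain ⟨c, -, rfl⟩ := hx
    obtain ⟨c', -, h⟩ := hx'
    exact hne (List.cons.inj h).2.symm

theorem nodup_foldl_extend {L : List (List (Fin 3))} (hL : L.Nodup) (cs : List (List ℕ)) :
    (cs.foldl extend L).Nodup := by
  induction cs generalizing L with
  | nil => exact hL
  | cons bs cs ih => exact ih (nodup_extend hL bs)

theorem length_of_mem_foldl_extend {L : List (List (Fin 3))} {m : ℕ}
    (hL : ∀ l ∈ L, l.length = m) (cs : List (List ℕ)) :
    ∀ l ∈ cs.foldl extend L, l.length = m + cs.length := by
  induction cs generalizing L m with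
  | nil => simpa using hL
  | cons bs cs ih =>
    intro l hl
    rw [ih (m := m + 1) _ l hl]
    · simp; omega
    · intro x hx
      obtain ⟨c, l, rfl, hl⟩ := exists_of_mem_extend hx
      simp [hL l hl]

/-- A sequence survives the enumeration exactly if it meets each local constraint when its entry is
added; entry `j` of a reversed list is the colour chosen `j + 1` steps earlier. -/
theorem initial_mem_foldl_extend (h : ℕ → Fin 3) (L : List (List (Fin 3))) (m : ℕ)
    (cs : List (List ℕ)) :
    initial h (m + cs.length) ∈ cs.foldl extend L ↔
      initial h m ∈ L ∧ ∀ i bs, cs[i]? = some bs → ∀ j ∈ bs,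
        (initial h (m + i))[j]? ≠ some (h (m + i)) := by
  induction cs using List.reverseRecOn with
  | nil => simp
  | append_singleton cs bs ih =>
    rw [List.foldl_append, List.length_append, List.length_singleton, ← add_assoc]
    simp only [List.foldl_cons, List.foldl_nil, initial]
    rw [cons_mem_extend, ih, and_assoc]
    refine and_congr_right fun _ => ?_
    constructor
    · rintro ⟨h1, h2⟩ i bs' hi j hj
      rcases lt_trichotomy i cs.length with hlt | rfl | hlt
      · rw [List.getElem?_append_left hlt] at hi
        exact h1 i bs' hi j hj
      · simp at hi
        exact h2 j (hi ▸ hj)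
      · rw [List.getElem?_eq_none (by simp; omega)] at hi
        cases hi
    · intro H
      refine ⟨fun i bs' hi j hj => H i bs' ?_ j hj, fun j hj => H cs.length bs (by simp) j hj⟩
      have : i < cs.length := by
        by_contra hcon
        rw [List.getElem?_eq_none (by omega)] at hi
        cases hi
      rw [List.getElem?_append_left this, hi]

/-- The colour patterns at the ends of an edge. -/
def EdgePattern (t : Fin 4 → Fin 3) : Prop :=
  t 0 ≠ t 1 ∧ t 2 ≠ t 3 ∧ (t 0 = t 2 ∧ t 1 = t 3 ∨ t 0 = t 3 ∧ t 1 = t 2)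

instance : DecidablePred EdgePattern := fun _ => by unfold EdgePattern; infer_instance

/-- The colour patterns at the ends of an edge, as reversed lists. -/
def edgePatterns : List (List (Fin 3)) :=
  ([(0, 1), (1, 0), (0, 2), (2, 0), (1, 2), (2, 1)] : List (Fin 3 × Fin 3)).flatMap fun p =>
    [[p.1, p.2, p.1, p.2], [p.1, p.2, p.2, p.1]]

theorem mem_edgePatterns (h : ℕ → Fin 3) :
    initial h 4 ∈ edgePatterns ↔ EdgePattern fun i => h i := by
  change [h 3, h 2, h 1, h 0] ∈ edgePatterns ↔
    (h 0 ≠ h 1 ∧ h 2 ≠ h 3 ∧ (h 0 = h 2 ∧ h 1 = h 3 ∨ h 0 = h 3 ∧ h 1 = h 2))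
  generalize h 0 = a, h 1 = b, h 2 = c, h 3 = d
  revert a b c d
  decide

theorem nodup_edgePatterns : edgePatterns.Nodup := by decide

/-- The position of an edge in the order of the enumeration. -/
def position {k q : ℕ} : Fin k ⊕ (Fin 4 ⊕ Fin q) → ℕ
  | .inl e => 4 + e
  | .inr (.inl i) => i
  | .inr (.inr i) => 4 + k + i

/-- The list `cs` describes, for every edge from the fifth one on, how far before it in the order of
the enumeration its neighbours are. -/
def Describes {k q : ℕ} (P : Pole V (Fin k) (Fin 4 ⊕ Fin q)) (cs : List (List ℕ)) : Prop :=
  cs.length = k + q ∧ (∀ i j : Fin 4, P.ter (.inl i) = P.ter (.inl j) → i = j) ∧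
    (∀ i : Fin (k + q), ∀ j ∈ cs.getD i [], j < 4 + (i : ℕ)) ∧
    ∀ x y, position y < position x → 4 ≤ position x →
      (position x - 1 - position y ∈ cs.getD (position x - 4) [] ↔ ∃ v, P.Inc x v ∧ P.Inc y v)

/-- The colours of all edges as a sequence. -/
def colours {k q : ℕ} (g : Fin k → Fin 3) (t : Fin 4 → Fin 3) (t' : Fin q → Fin 3) (i : ℕ) :
    Fin 3 :=
  if h : i < 4 then t ⟨i, h⟩
  else if h' : i - 4 < k then g ⟨i - 4, h'⟩
  else if h'' : i - 4 - k < q then t' ⟨i - 4 - k, h''⟩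
  else 0

theorem colours_position {k q : ℕ} (g : Fin k → Fin 3) (t : Fin 4 → Fin 3) (t' : Fin q → Fin 3)
    (x : Fin k ⊕ (Fin 4 ⊕ Fin q)) :
    colours g t t' (position x) = Sum.elim g (Sum.elim t t') x := by
  rcases x with e | i | i
  · simp [position, colours]
  · simp [position, colours]
  · have h1 : ¬ 4 + k + (i : ℕ) < 4 := by omega
    have h2 : ¬ 4 + k + (i : ℕ) - 4 < k := by omega
    have h3 : 4 + k + (i : ℕ) - 4 - k = i := by omega
    simp [position, colours, h1, h2, h3]

theorem exists_position {k q : ℕ} {i : ℕ} (hi : i < 4 + (k + q)) :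
    ∃ x : Fin k ⊕ (Fin 4 ⊕ Fin q), position x = i := by
  by_cases h : i < 4
  · exact ⟨.inr (.inl ⟨i, h⟩), rfl⟩
  by_cases h' : i - 4 < k
  · exact ⟨.inl ⟨i - 4, h'⟩, by simp [position]; omega⟩
  · exact ⟨.inr (.inr ⟨i - 4 - k, by omega⟩), by simp [position]; omega⟩

theorem position_lt {k q : ℕ} (x : Fin k ⊕ (Fin 4 ⊕ Fin q)) : position x < 4 + (k + q) := by
  rcases x with e | i | i <;> simp only [position] <;> omega

theorem position_inj {k q : ℕ} {x y : Fin k ⊕ (Fin 4 ⊕ Fin q)} (h : position x = position y) :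
    x = y := by
  rcases x with e | i | i <;> rcases y with e' | i' | i' <;> simp only [position] at h <;>
    first | omega | (congr; omega)

/-- Each conflicting pair of edges is tested once, when the later edge is coloured. The first four
dangling edges need no test among themselves because their ends are distinct. -/
theorem Describes.proper_iff {k q : ℕ} {P : Pole V (Fin k) (Fin 4 ⊕ Fin q)} {cs : List (List ℕ)}
    (hP : P.Describes cs) (g : Fin k → Fin 3) (t : Fin 4 → Fin 3) (t' : Fin q → Fin 3) :
    P.Proper g (Sum.elim t t') ↔ ∀ i bs, cs[i]? = some bs → ∀ j ∈ bs,
      (initial (colours g t t') (4 + i))[j]? ≠ some (colours g t t' (4 + i)) := by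
  obtain ⟨hlen, hinj, hlt, hadj⟩ := hP
  constructor
  · intro H i bs hi j hj
    have hi' : i < cs.length := by
      by_contra hcon
      rw [List.getElem?_eq_none (by omega)] at hi
      cases hi
    have hbs : cs.getD i [] = bs := by simp [List.getD, hi]
    have hj4 : j < 4 + i := hlt ⟨i, hlen ▸ hi'⟩ j (hbs ▸ hj)
    rw [getElem?_initial _ _ _ hj4]
    obtain ⟨x, hx⟩ := exists_position (k := k) (q := q) (i := 4 + i) (by omega)
    obtain ⟨y, hy⟩ := exists_position (k := k) (q := q) (i := 4 + i - 1 - j) (by omega)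
    obtain ⟨v, hxv, hyv⟩ := (hadj x y (by omega) (by omega)).1 (by
      rw [hx, hy, show 4 + i - 4 = i by omega, hbs,
        show 4 + i - 1 - (4 + i - 1 - j) = j by omega]
      exact hj)
    have := H v x y hxv hyv (by rintro rfl; omega)
    rw [← colours_position, ← colours_position, hx, hy] at this
    simpa using this.symm
  · intro H
    have key : ∀ v x y, P.Inc x v → P.Inc y v → position y < position x →
        Sum.elim g (Sum.elim t t') x ≠ Sum.elim g (Sum.elim t t') y := by
      intro v x y hx hy hxy
      by_cases h4 : 4 ≤ position x
      · have hm := (hadj x y hxy h4).2 ⟨v, hx, hy⟩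
        have hxl := position_lt x
        have hs : cs[position x - 4]? = some (cs.getD (position x - 4) []) := by
          rw [List.getD, List.getElem?_eq_getElem (by omega)]
          rfl
        have := H _ _ hs _ hm
        rw [show 4 + (position x - 4) = position x by omega,
          getElem?_initial _ _ _ (by omega),
          show position x - 1 - (position x - 1 - position y) = position y by omega,
          colours_position, colours_position] at this
        exact fun h => this (by rw [h])
      · rcases x with x | x | x <;> rcases y with y | y | y <;> simp only [position] at hxy h4 <;>
          try omega
        have := hinj x y (hx.trans hy.symm)
        subst this
        omega
    intro v x y hx hy hxy
    rcases lt_trichotomy (position x) (position y) with h | h | h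
    · exact (key v y x hy hx h).symm
    · exact (hxy (position_inj h)).elim
    · exact key v x y hx hy h

/-- This turns a count of colourings into the length of a computable list. The dangling edges
indexed by `Fin q` are enumerated last, so their colours head the reversed lists. -/
theorem Describes.sum_count {k q : ℕ} {P : Pole V (Fin k) (Fin 4 ⊕ Fin q)} {cs : List (List ℕ)}
    (hP : P.Describes cs) (t' : Fin q → Fin 3) :
    ∑ t : Fin 4 → Fin 3, (if EdgePattern t then 1 else 0) * P.count (Sum.elim t t') =
      ((cs.foldl extend edgePatterns).filter fun l => decide
        (∀ i : Fin q, l[q - 1 - i]? = some (t' i))).length := by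
  classical
  have hM : ∀ l ∈ cs.foldl extend edgePatterns, l.length = 4 + cs.length :=
    length_of_mem_foldl_extend (by decide) cs
  have hlen := hP.1
  have hnd := (nodup_foldl_extend nodup_edgePatterns cs).filter
    (fun l => decide (∀ i : Fin q, l[q - 1 - i]? = some (t' i)))
  have hmem : ∀ l, l ∈ (cs.foldl extend edgePatterns).filter (fun l => decide
      (∀ i : Fin q, l[q - 1 - i]? = some (t' i))) ↔
      l ∈ cs.foldl extend edgePatterns ∧ ∀ i : Fin q, l[q - 1 - i]? = some (t' i) := by
    intro l
    rw [List.mem_filter, decide_eq_true_eq]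
  generalize (cs.foldl extend edgePatterns).filter (fun l => decide
    (∀ i : Fin q, l[q - 1 - i]? = some (t' i))) = R at hnd hmem ⊢
  rw [← List.toFinset_card_of_nodup hnd]
  have e : {p : (Fin 4 → Fin 3) × (Fin k → Fin 3) //
      EdgePattern p.1 ∧ P.Proper p.2 (Sum.elim p.1 t')} ≃
      (Σ t : Fin 4 → Fin 3, {g : Fin k → Fin 3 // EdgePattern t ∧ P.Proper g (Sum.elim t t')}) :=
    { toFun := fun p => ⟨p.1.1, p.1.2, p.2⟩
      invFun := fun p => ⟨(p.1, p.2.1), p.2.2⟩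
      left_inv := fun _ => rfl
      right_inv := fun _ => rfl }
  have hl : ∑ t : Fin 4 → Fin 3, (if EdgePattern t then 1 else 0) * P.count (Sum.elim t t') =
      Nat.card {p : (Fin 4 → Fin 3) × (Fin k → Fin 3) //
        EdgePattern p.1 ∧ P.Proper p.2 (Sum.elim p.1 t')} := by
    rw [Nat.card_congr e, Nat.card_sigma]
    refine Finset.sum_congr rfl fun t _ => ?_
    by_cases ht : EdgePattern t <;> simp [ht, count]
  rw [hl, ← Fintype.card_coe, ← Nat.card_eq_fintype_card]
  have hterm : ∀ (h : ℕ → Fin 3) (i : Fin q),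
      (initial h (4 + cs.length))[q - 1 - i]? = some (h (4 + k + i)) := by
    intro h i
    rw [getElem?_initial _ _ _ (by omega),
      show 4 + cs.length - 1 - (q - 1 - (i : ℕ)) = 4 + k + i by omega]
  have hinit : ∀ (g : Fin k → Fin 3) (t : Fin 4 → Fin 3),
      (fun i : Fin 4 => colours g t t' i) = t := fun g t => by
    ext i
    exact congrArg Fin.val (colours_position g t t' (.inr (.inl i)))
  refine Nat.card_congr (Equiv.ofBijective
    (fun p => (⟨initial (colours p.1.2 p.1.1 t') (4 + cs.length), ?_⟩ : {l // l ∈ R.toFinset}))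
    ⟨?_, ?_⟩)
  · obtain ⟨⟨t, g⟩, ht, hg⟩ := p
    rw [List.mem_toFinset, hmem, initial_mem_foldl_extend, mem_edgePatterns, hinit]
    refine ⟨⟨ht, (hP.proper_iff g t t').1 hg⟩, fun i => ?_⟩
    rw [hterm]
    exact congrArg some (colours_position g t t' (.inr (.inr i)))
  · rintro ⟨⟨t, g⟩, ht, hg⟩ ⟨⟨t₁, g₁⟩, ht₁, hg₁⟩ h
    have H := initial_inj (congrArg Subtype.val h)
    have H' : ∀ x : Fin k ⊕ (Fin 4 ⊕ Fin q), Sum.elim g (Sum.elim t t') x =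
        Sum.elim g₁ (Sum.elim t₁ t') x := fun x => by
      rw [← colours_position, ← colours_position]
      exact H _ (by rw [hlen]; exact position_lt x)
    have h1 : t = t₁ := funext fun i => H' (.inr (.inl i))
    have h2 : g = g₁ := funext fun i => H' (.inl i)
    subst h1 h2
    rfl
  · rintro ⟨l, hl⟩
    have hl' := hl
    rw [List.mem_toFinset, hmem] at hl'
    obtain ⟨hl1, hl2⟩ := hl'
    have hll := hM l hl1
    obtain ⟨h, rfl⟩ : ∃ h, l = initial h (4 + cs.length) := ⟨_, hll ▸ eq_initial l⟩
    let t : Fin 4 → Fin 3 := fun i => h i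
    let g : Fin k → Fin 3 := fun i => h (4 + i)
    have hc : ∀ i < 4 + cs.length, colours g t t' i = h i := by
      intro i hi
      obtain ⟨x, rfl⟩ := exists_position (k := k) (q := q) (i := i) (by omega)
      rw [colours_position]
      rcases x with x | x | x
      · rfl
      · rfl
      · have := hl2 x
        rw [hterm] at this
        exact (Option.some.inj this).symm
    have hc' := initial_congr hc
    rw [← hc', initial_mem_foldl_extend, mem_edgePatterns, hinit] at hl1
    exact ⟨⟨(t, g), hl1.1, (hP.proper_iff g t t').2 hl1.2⟩, Subtype.ext hc'⟩

/-! ### Enumeration of small cuts -/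

/-- Extend every side assignment in `L` by one vertex whose earlier neighbours are at the positions
`bs`, and keep those with at most three edges in the cut. -/
def extendCut (L : List (List Bool × ℕ)) (bs : List ℕ) : List (List Bool × ℕ) :=
  L.flatMap fun p =>
    ([true, false].map fun b =>
      (b :: p.1, p.2 + (bs.map fun j => if p.1[j]? = some b then 0 else 1).sum)).filter
      fun r => decide (r.2 ≤ 3)

/-- The list of edges described by a list of relative positions of earlier neighbours. -/
def cutPairs : ℕ → List (List ℕ) → List (ℕ × ℕ)
  | _, [] => []
  | i, bs :: cs => bs.map (fun j => (i - 1 - j, i)) ++ cutPairs (i + 1) cs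

/-- All relative positions in the list are meaningful. -/
def wellFormed : ℕ → List (List ℕ) → Bool
  | _, [] => true
  | i, bs :: cs => bs.all (fun j => decide (j < i)) && wellFormed (i + 1) cs

/-- The number of edges in a list that are in the cut given by `Z`. -/
def cutSize (Z : ℕ → Bool) (L : List (ℕ × ℕ)) : ℕ := (L.map fun p => sep (Z p.1) (Z p.2)).sum

theorem cutSize_append (Z : ℕ → Bool) (L L' : List (ℕ × ℕ)) :
    cutSize Z (L ++ L') = cutSize Z L + cutSize Z L' := by
  simp [cutSize]

/-- Pruning loses nothing: the number of cut edges never decreases as vertices are added. -/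
theorem initial_mem_foldl_extendCut (Z : ℕ → Bool) (cs : List (List ℕ)) :
    ∀ (i c : ℕ) (L : List (List Bool × ℕ)), wellFormed i cs = true → (initial Z i, c) ∈ L →
      c + cutSize Z (cutPairs i cs) ≤ 3 →
      (initial Z (i + cs.length), c + cutSize Z (cutPairs i cs)) ∈ cs.foldl extendCut L := by
  induction cs with
  | nil => intro i c L _ h _; simpa [cutPairs, cutSize] using h
  | cons bs cs ih =>
    intro i c L hwf hmem hle
    simp only [wellFormed, Bool.and_eq_true, List.all_eq_true, decide_eq_true_eq] at hwf
    have hs : (bs.map fun j => if (initial Z i)[j]? = some (Z i) then 0 else 1).sum =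
        cutSize Z (bs.map fun j => (i - 1 - j, i)) := by
      rw [cutSize, List.map_map]
      congr 1
      refine List.map_congr_left fun j hj => ?_
      rw [getElem?_initial _ _ _ (hwf.1 j hj)]
      simp only [Function.comp_apply, Option.some.injEq]
      generalize Z (i - 1 - j) = a, Z i = b
      revert a b
      decide
    rw [cutPairs, cutSize_append, ← add_assoc] at hle ⊢
    rw [List.length_cons, add_comm cs.length 1, ← add_assoc]
    refine ih (i + 1) _ _ hwf.2 ?_ hle
    rw [extendCut, List.mem_flatMap]
    refine ⟨_, hmem, List.mem_filter.2 ⟨List.mem_map.2 ⟨Z i, ?_, ?_⟩, ?_⟩⟩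
    · cases Z i <;> simp
    · rw [hs]
      rfl
    · simp only [decide_eq_true_eq]
      omega

theorem one_le_count_initial (Z : ℕ → Bool) (m i : ℕ) (hi : i < m) :
    1 ≤ (initial Z m).count (Z i) := by
  induction m with
  | zero => omega
  | succ m ih =>
    rw [initial, List.count_cons]
    rcases Nat.lt_succ_iff_lt_or_eq.1 hi with h | rfl
    · have := ih h
      omega
    · simp

theorem two_le_count_initial (Z : ℕ → Bool) (m i j : ℕ) (hij : i < j) (hj : j < m)
    (h : Z i = Z j) : 2 ≤ (initial Z m).count (Z j) := by
  induction m with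
  | zero => omega
  | succ m ih =>
    rw [initial, List.count_cons]
    rcases Nat.lt_succ_iff_lt_or_eq.1 hj with hj | rfl
    · have := ih hj
      omega
    · have := one_le_count_initial Z j i hij
      rw [h] at this
      simpa using this

/-- The edges of the graph obtained by completing a pole by two adjacent vertices `0` and `1`. -/
def completedEdges {n k : ℕ} (P : Pole (Fin n) (Fin k) (Fin 4 ⊕ T)) : List (ℕ × ℕ) :=
  (0, 1) :: (0, P.ter (.inl 0) + 2) :: (0, P.ter (.inl 1) + 2) :: (1, P.ter (.inl 2) + 2) ::
    (1, P.ter (.inl 3) + 2) :: List.ofFn fun e => ((P.src e + 2 : ℕ), (P.dst e + 2 : ℕ))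

/-- Extend a vertex set to the two additional vertices. -/
def completion {n : ℕ} (Y : Fin n → Bool) (p q : Bool) (i : ℕ) : Bool :=
  if i = 0 then p else if i = 1 then q else if h : i - 2 < n then Y ⟨i - 2, h⟩ else false

theorem completion_add_two {n : ℕ} (Y : Fin n → Bool) (p q : Bool) (i : Fin n) :
    completion Y p q (i + 2) = Y i := by
  simp [completion]

theorem cutSize_completedEdges {n k : ℕ} (P : Pole (Fin n) (Fin k) (Fin 4 ⊕ T))
    (Y : Fin n → Bool) (p q : Bool) :
    cutSize (completion Y p q) (completedEdges P) =
      P.cut Y + pairCost (Y ∘ P.ter ∘ Sum.inl) p q := by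
  have h0 : completion Y p q 0 = p := rfl
  have h1 : completion Y p q 1 = q := rfl
  simp only [cutSize, completedEdges, List.map_cons, List.sum_cons, completion_add_two, h0, h1,
    pairCost, cut, Function.comp_apply, List.map_ofFn, List.sum_ofFn]
  ring

/-- The number of edges in a cut among the additional edges in the list. -/
def extraCut {n : ℕ} (ex : List (Fin n × Fin n)) (Y : Fin n → Bool) : ℕ :=
  (ex.map fun p => sep (Y p.1) (Y p.2)).sum

/-- The completed graph is given by `cs` as a sequence of vertices with their earlier neighbours,
the new pair being 0 and 1. `hperm` checks that `cs` lists the right edges; `hcheck` that cuts of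
size at most three isolate at most one vertex, and that those of size at most two are trivial. -/
theorem completedCuts {n k : ℕ} {P : Pole (Fin n) (Fin k) (Fin 4 ⊕ T)}
    (ex : List (Fin n × Fin n)) (cs : List (List ℕ)) (hn : 3 ≤ n) (hlen : cs.length = n + 2)
    (hwf : wellFormed 0 cs = true)
    (hperm : ((completedEdges P ++ ex.map fun p => ((p.1 + 2 : ℕ), (p.2 + 2 : ℕ))).map
      fun p => (min p.1 p.2, max p.1 p.2)).Perm (cutPairs 0 cs))
    (hcheck : ((cs.foldl extendCut [([], 0)]).all fun p =>
      (decide (p.1.count true ≤ 1) || decide (p.1.count false ≤ 1)) &&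
      (decide (3 ≤ p.2) || decide (p.1.count true = 0) || decide (p.1.count false = 0))) = true) :
    P.CompletedCuts (extraCut ex) := by
  have htotal : ∀ Y p q, P.cut Y + extraCut ex Y + pairCost (Y ∘ P.ter ∘ Sum.inl) p q =
      cutSize (completion Y p q) (cutPairs 0 cs) := by
    intro Y p q
    have h1 : cutSize (completion Y p q) (cutPairs 0 cs) = cutSize (completion Y p q)
        (completedEdges P ++ ex.map fun p => ((p.1 + 2 : ℕ), (p.2 + 2 : ℕ))) := by
      unfold cutSize
      rw [← (hperm.map fun p' => sep (completion Y p q p'.1) (completion Y p q p'.2)).sum_eq,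
        List.map_map]
      congr 1
      refine List.map_congr_left fun r _ => ?_
      simp only [Function.comp_apply]
      rcases le_total r.1 r.2 with h | h
      · rw [min_eq_left h, max_eq_right h]
      · rw [min_eq_right h, max_eq_left h]
        generalize completion Y p q r.1 = a, completion Y p q r.2 = b
        revert a b
        decide
    rw [h1, cutSize_append, cutSize_completedEdges]
    have h2 : cutSize (completion Y p q) (ex.map fun p => ((p.1 + 2 : ℕ), (p.2 + 2 : ℕ))) =
        extraCut ex Y := by
      simp [cutSize, extraCut, Function.comp_def, completion_add_two]
    rw [h2]
    ring
  have key : ∀ Y p q,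
      (3 ≤ P.cut Y + extraCut ex Y + pairCost (Y ∘ P.ter ∘ Sum.inl) p q ∨
        ∃ b, (initial (completion Y p q) (n + 2)).count b = 0) ∧
      (4 ≤ P.cut Y + extraCut ex Y + pairCost (Y ∘ P.ter ∘ Sum.inl) p q ∨
        ∃ b, (initial (completion Y p q) (n + 2)).count b ≤ 1) := by
    intro Y p q
    rw [htotal]
    by_cases hle : cutSize (completion Y p q) (cutPairs 0 cs) ≤ 3
    · have hmem := initial_mem_foldl_extendCut (completion Y p q) cs 0 0 [([], 0)] hwf
        (by simp [initial]) (by simpa using hle)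
      have := List.all_eq_true.1 hcheck _ hmem
      simp only [Bool.and_eq_true, Bool.or_eq_true, decide_eq_true_eq, zero_add, hlen] at this
      obtain ⟨h1, h2⟩ := this
      refine ⟨?_, .inr (h1.elim (fun h => ⟨_, h⟩) fun h => ⟨_, h⟩)⟩
      rcases h2 with (h2 | h2) | h2
      · exact .inl h2
      · exact .inr ⟨_, h2⟩
      · exact .inr ⟨_, h2⟩
    · exact ⟨.inl (by omega), .inl (by omega)⟩
  have one : ∀ (Y : Fin n → Bool) p q v,
      1 ≤ (initial (completion Y p q) (n + 2)).count (Y v) := by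
    intro Y p q v
    have := one_le_count_initial (completion Y p q) (n + 2) (v + 2) (by omega)
    rwa [completion_add_two] at this
  have two : ∀ (Y : Fin n → Bool) p q b, Two Y b →
      2 ≤ (initial (completion Y p q) (n + 2)).count b := by
    rintro Y p q b ⟨v, w, hvw, hv, hw⟩
    wlog hlt : v < w generalizing v w
    · exact this w v hvw.symm hw hv (lt_of_le_of_ne (not_lt.1 hlt) hvw.symm)
    have := two_le_count_initial (completion Y p q) (n + 2) (v + 2) (w + 2) (by simpa using hlt)
      (by omega) (by rw [completion_add_two, completion_add_two, hv, hw])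
    rwa [completion_add_two, hw] at this
  have aux : ∀ b b' : Bool, b' = b ∨ b' = !b := by decide
  refine ⟨fun b => by simp [extraCut, sep_self], fun Y => ?_, fun Y p q hY => ?_,
    fun Y b p q hb hY hpq => ?_, fun Y b hb => ?_⟩
  · have aux : ∀ a b c : Bool, a = b ∨ a = c ∨ b = c := by decide
    rcases aux (Y ⟨0, by omega⟩) (Y ⟨1, by omega⟩) (Y ⟨2, by omega⟩) with h | h | h
    · exact ⟨_, _, _, by simp, h, rfl⟩
    · exact ⟨_, _, _, by simp, h, rfl⟩
    · exact ⟨_, _, _, by simp, h, rfl⟩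
  · refine (key Y p q).1.resolve_right ?_
    rintro ⟨b, hb⟩
    have : ∀ v, Y v = !b := fun v => by
      have h1 := one Y p q v
      refine (aux b (Y v)).resolve_left fun hv => ?_
      rw [hv, hb] at h1
      omega
    obtain ⟨v, w, hvw⟩ := hY
    exact hvw (by rw [this, this])
  · refine (key Y p q).2.resolve_right ?_
    rintro ⟨b', hb'⟩
    have h2 := two Y p q b hb
    obtain ⟨v, hv⟩ := hY
    -- Side `!b` contains the socket vertex `v` and a vertex of the pair.
    have hn : 2 ≤ (initial (completion Y p q) (n + 2)).count (!b) := by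
      rcases hpq with h | h
      · have hp : completion Y p q 0 = completion Y p q (v + 2) := by
          rw [completion_add_two, hv]
          exact (aux b p).resolve_left h
        have := two_le_count_initial (completion Y p q) (n + 2) 0 (v + 2) (by omega) (by omega) hp
        rwa [completion_add_two, hv] at this
      · have hp : completion Y p q 1 = completion Y p q (v + 2) := by
          rw [completion_add_two, hv]
          exact (aux b q).resolve_left h
        have := two_le_count_initial (completion Y p q) (n + 2) 1 (v + 2) (by omega) (by omega) hp
        rwa [completion_add_two, hv] at this
    rcases aux b b' with rfl | rfl <;> omega
  · refine (key Y b b).2.resolve_right ?_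
    rintro ⟨b', hb'⟩
    have h2 := two Y b b _ hb
    have h3 := two_le_count_initial (completion Y b b) (n + 2) 0 1 (by omega) (by omega) rfl
    change 2 ≤ (initial (completion Y b b) (n + 2)).count b at h3
    rcases aux b b' with rfl | rfl <;> omega

/-! ### Edge-like poles, sockets and edge subtraction -/

/-- `D` may replace a pair of adjacent vertices in a snark, and it multiplies numbers of colourings
by `m`. -/
structure EdgeLike [Fintype V] [Fintype E] [DecidableEq V] (D : Pole V E (Fin 4)) (m : ℕ) :
    Prop where
  girth : D.GirthFive
  paired : D.Paired
  degree : ∀ v, D.degree v = 3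
  cuts : D.PairLikeCuts
  count : ∀ t, D.count t = if EdgePattern t then m else 0

/-- `B` comes from a cyclically 4-edge-connected cubic graph without short cycles by the deletion of
two adjacent vertices, and of additional edges with `c` of them in a cut. -/
structure Socket [Fintype F] [Fintype T] [DecidableEq W] (B : Pole W F (Fin 4 ⊕ T))
    (c : (W → Bool) → ℕ) : Prop where
  girth : B.GirthFive
  spread : B.Spread
  degree : ∀ w, B.degree w = 3
  cuts : B.CompletedCuts c

/-- The number of colourings of `B` such that the colours of the first four dangling edges form a
pattern occurring at the ends of an edge. -/
noncomputable def patternCount (B : Pole W F (Fin 4 ⊕ T)) (t' : T → Fin 3) : ℕ :=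
  ∑ t : Fin 4 → Fin 3, (if EdgePattern t then 1 else 0) * B.count (Sum.elim t t')

theorem EdgeLike.glue_count [Fintype V] [Fintype E] [DecidableEq V] [Finite F]
    {D : Pole V E (Fin 4)} {m : ℕ} (hD : D.EdgeLike m) (B : Pole W F (Fin 4 ⊕ T))
    (t' : T → Fin 3) : (D.glue B).count t' = m * B.patternCount t' := by
  rw [Pole.glue_count, patternCount, Finset.mul_sum]
  refine Finset.sum_congr rfl fun t _ => ?_
  rw [hD.count]
  split_ifs <;> simp

/-- With the two cut edges put back, the glued pole is a cubic graph without small cuts; this is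
what makes the new pole pair-like again. -/
theorem EdgeLike.glue [Fintype V] [Fintype E] [DecidableEq V] [Fintype W] [Fintype F]
    [DecidableEq W] {D : Pole V E (Fin 4)} {m m' : ℕ} (hD : D.EdgeLike m)
    {B : Pole W F (Fin 4 ⊕ Fin 4)} (hB : B.Socket fun Y => closingCut (Y ∘ B.ter ∘ Sum.inr))
    (hinj : ∀ i j, B.ter (.inr i) = B.ter (.inr j) → i = j)
    (hcount : ∀ t', B.patternCount t' = if EdgePattern t' then m' else 0) :
    (D.glue B).EdgeLike (m * m') := by
  have hinj' : Function.Injective (D.glue B).ter := fun i j h => hinj i j (Sum.inr.inj h)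
  refine ⟨hD.girth.glue hB.girth hD.paired hB.spread, fun i j h => by rw [hinj' h], ?_,
    NoSmallCuts.pairLikeCuts hinj' (glue_noSmallCuts hD.cuts hB.cuts), fun t => ?_⟩
  · rintro (v | w)
    · rw [glue_degree_inl, hD.degree]
    · rw [glue_degree_inr, hB.degree]
  · rw [hD.glue_count, hcount]
    split_ifs <;> simp

/-- `B'` arises from `B` by edge subtraction along `uv`. -/
structure Subtracts {W' F' : Type} (B : Pole W F (Fin 4 ⊕ T)) (B' : Pole W' F' (Fin 4 ⊕ T))
    (ι : W' → W) (u v : W) : Prop where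
  inj : Function.Injective ι
  ne_left : ∀ a, ι a ≠ u
  ne_right : ∀ a, ι a ≠ v
  cover : ∀ w, w = u ∨ w = v ∨ ∃ a, ι a = w
  adj : B.Adj u v
  ter : ∀ i, B.ter (.inl i) = ι (B'.ter (.inl i))
  adj_iff : ∀ a b, B'.Adj a b ↔ B.Adj (ι a) (ι b) ∨
    a ≠ b ∧ (B.Adj u (ι a) ∧ B.Adj u (ι b) ∨ B.Adj v (ι a) ∧ B.Adj v (ι b))

/-- The subtracted edge lies inside the socket and its ends carry no junction edge, so subtraction
commutes with gluing. Colourings are then counted by `EdgeLike.glue_count`, for `B` (none) and for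
`B'`. -/
theorem EdgeLike.exists_isSnark [Fintype V] [Fintype E] [DecidableEq V] [Fintype W] [Fintype F]
    [DecidableEq W] {W' F' : Type} [Fintype F'] {D : Pole V E (Fin 4)} {m m' : ℕ}
    (hD : D.EdgeLike m) {B : Pole W F (Fin 4 ⊕ Fin 0)} {B' : Pole W' F' (Fin 4 ⊕ Fin 0)}
    (hB : B.Socket fun _ => 0) {ι : W' → W} {u v : W} (h : B.Subtracts B' ι u v)
    (hcount : ∀ t', B.patternCount t' = 0) (hB' : B'.Simple)
    (hcount' : ∀ t', B'.patternCount t' = 18 * m') :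
    ∃ (V : Type) (G : SimpleGraph V) (e : Sym2 V), IsSnark G ∧ e ∈ G.edgeSet ∧
      numColourings G e = 18 * (m * m') := by
  have hK := hD.girth.glue hB.girth hD.paired hB.spread
  have hinj' : ∀ i j, B'.ter (.inl i) = B'.ter (.inl j) → i = j := fun i j hij =>
    hB.spread.inj i j (by rw [h.ter, h.ter, hij])
  have hK' : (D.glue B').Simple := hD.girth.toSimple.glue hB' hinj'
  have hne : ∀ i, B.ter (.inl i) ≠ u ∧ B.ter (.inl i) ≠ v := fun i => by
    rw [h.ter]
    exact ⟨h.ne_left _, h.ne_right _⟩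
  have : Nonempty (V ⊕ W) := ⟨.inr u⟩
  refine ⟨V ⊕ W, (D.glue B).graph, s(.inr u, .inr v), hK.isSnark (t := isEmptyElim) ?_ ?_ ?_,
    ?_, ?_⟩
  · rintro (v | w)
    · rw [glue_degree_inl, hD.degree]
    · rw [glue_degree_inr, hB.degree]
  · exact glue_noSmallCuts hD.cuts hB.cuts
  · rw [hD.glue_count, hcount, mul_zero]
  · rw [SimpleGraph.mem_edgeSet, hK.graph_adj, glue_adj_inr_inr]
    exact h.adj
  · let f : V ⊕ W' → {w : V ⊕ W // w ∉ s(Sum.inr u, Sum.inr v)} := fun x =>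
      ⟨Sum.map id ι x, by rcases x with x | x <;> simp [h.ne_left, h.ne_right]⟩
    have hf : Function.Bijective f := by
      refine ⟨fun x y hxy => ?_, ?_⟩
      · exact Function.Injective.sumMap Function.injective_id h.inj (congrArg Subtype.val hxy)
      · rintro ⟨x | w, hx⟩
        · exact ⟨.inl x, rfl⟩
        · simp only [Sym2.mem_iff, Sum.inr.injEq, not_or] at hx
          obtain ⟨a, rfl⟩ := ((h.cover w).resolve_left hx.1).resolve_left hx.2
          exact ⟨.inr a, rfl⟩
    have iso : (D.glue B').graph ≃g edgeSubtract (D.glue B).graph s(.inr u, .inr v) :=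
      { toEquiv := Equiv.ofBijective f hf
        map_rel_iff' := by
          intro x y
          simp only [Equiv.ofBijective_apply, edgeSubtract, hK.graph_adj, hK'.graph_adj,
            Sym2.mem_iff, exists_eq_or_imp, exists_eq_left, ne_eq, hf.1.eq_iff]
          rcases x with x | x <;> rcases y with y | y
          · simp [f, hne]
          · simp [f, h.ter, h.inj.eq_iff, h.ne_left, h.ne_right]
          · simp [f, h.ter, h.inj.eq_iff, h.ne_left, h.ne_right]
          · simp [f, h.adj_iff] }
    rw [numColourings, ← Nat.card_congr (SimpleGraph.coloringCongr iso.lineGraph (Equiv.refl (Fin 3))),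
      hK'.card_threeEdgeColouring isEmptyElim, hD.glue_count, hcount']
    ring

/-! ### Decision procedures for concrete poles -/

instance [DecidableEq V] (P : Pole V E T) : ∀ x v, Decidable (P.Inc x v)
  | .inl e, v => inferInstanceAs (Decidable (P.src e = v ∨ P.dst e = v))
  | .inr i, v => inferInstanceAs (Decidable (P.ter i = v))

instance [Fintype E] [DecidableEq V] (P : Pole V E T) (v w : V) : Decidable (P.Adj v w) := by
  unfold Adj; infer_instance

instance [Fintype V] [Fintype E] [Fintype T] [DecidableEq V] [DecidableEq E] [DecidableEq T]
    (P : Pole V E T) (f : E → Fin 3) (t : T → Fin 3) : Decidable (P.Proper f t) := by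
  unfold Proper; infer_instance

instance {n k q : ℕ} (P : Pole (Fin n) (Fin k) (Fin 4 ⊕ Fin q)) (cs : List (List ℕ)) :
    Decidable (P.Describes cs) := by
  unfold Describes; infer_instance

/-- `nb` lists the neighbours of every vertex, and there are no cycles of length at most four. -/
def GirthFiveCheck {n k : ℕ} (P : Pole (Fin n) (Fin k) T) (nb : Fin n → List (Fin n)) : Prop :=
  (∀ e, P.src e ≠ P.dst e) ∧ (∀ e e', P.src e = P.src e' → P.dst e = P.dst e' → e = e') ∧
    (∀ e e', P.src e = P.dst e' → P.dst e ≠ P.src e') ∧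
    (∀ e, P.dst e ∈ nb (P.src e) ∧ P.src e ∈ nb (P.dst e)) ∧
    (∀ u, ∀ v ∈ nb u, ∀ w ∈ nb v, u ∉ nb w) ∧
    ∀ u, ∀ w ∈ nb u, ∀ v ∈ nb w, ∀ x ∈ nb v, u ∈ nb x → u = v ∨ w = x

instance {n k : ℕ} (P : Pole (Fin n) (Fin k) T) (nb : Fin n → List (Fin n)) :
    Decidable (P.GirthFiveCheck nb) := by
  unfold GirthFiveCheck
  have h : Decidable (∀ u, ∀ w ∈ nb u, ∀ v ∈ nb w, ∀ x ∈ nb v, u ∈ nb x → u = v ∨ w = x) :=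
    inferInstance
  infer_instance

theorem GirthFiveCheck.girthFive {n k : ℕ} {P : Pole (Fin n) (Fin k) T}
    {nb : Fin n → List (Fin n)} (h : P.GirthFiveCheck nb) : P.GirthFive := by
  obtain ⟨h1, h2, h3, h4, h5, h6⟩ := h
  have hnb : ∀ {v w}, P.Adj v w → w ∈ nb v := by
    rintro v w ⟨e, ⟨rfl, rfl⟩ | ⟨rfl, rfl⟩⟩
    · exact (h4 e).1
    · exact (h4 e).2
  exact ⟨⟨h1, h2, h3⟩, fun u v w huv hvw hwu => h5 u v (hnb huv) w (hnb hvw) (hnb hwu),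
    fun u v w x huw hwv hvx hxu => h6 u w (hnb huw) v (hnb hwv) x (hnb hvx) (hnb hxu)⟩

instance {n k q : ℕ} (P : Pole (Fin n) (Fin k) (Fin 4 ⊕ Fin q)) : Decidable P.Spread :=
  decidable_of_iff ((∀ i j : Fin 4, P.ter (.inl i) = P.ter (.inl j) → i = j) ∧
    (∀ i j : Fin 4, ¬ P.Adj (P.ter (.inl i)) (P.ter (.inl j))) ∧
    ∀ i j : Fin 4, i ≠ j → (i : ℕ) / 2 = j / 2 → ∀ w,
      P.Adj (P.ter (.inl i)) w → ¬ P.Adj w (P.ter (.inl j)))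
    ⟨fun h => ⟨h.1, h.2.1, h.2.2⟩, fun h => ⟨h.1, h.2, h.3⟩⟩

/-- The colours of the last four dangling edges run through all edge patterns `m` times, and through
nothing else. Each edge pattern is listed once in `edgePatterns`. -/
theorem patternCount_of_perm {k : ℕ} {P : Pole V (Fin k) (Fin 4 ⊕ Fin 4)} {cs : List (List ℕ)}
    (hP : P.Describes cs) {m : ℕ} (h : ((cs.foldl extend edgePatterns).map (·.take 4)).Perm
      (List.replicate m edgePatterns).flatten) (t' : Fin 4 → Fin 3) :
    P.patternCount t' = if EdgePattern t' then m else 0 := by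
  rw [patternCount, hP.sum_count, ← List.countP_eq_length_filter]
  have h1 : ∀ L : List (List (Fin 3)),
      L.countP (fun l => decide (∀ i : Fin 4, l[4 - 1 - (i : ℕ)]? = some (t' i))) =
      (L.map (·.take 4)).countP
        (fun l => decide (∀ i : Fin 4, l[4 - 1 - (i : ℕ)]? = some (t' i))) := by
    intro L
    rw [List.countP_map]
    refine List.countP_congr fun l _ => ?_
    simp only [Function.comp_apply, decide_eq_true_eq]
    refine forall_congr' fun i => ?_
    rw [List.getElem?_take_of_lt (by omega)]
  have h2 : edgePatterns.countP
      (fun l => decide (∀ i : Fin 4, l[4 - 1 - (i : ℕ)]? = some (t' i))) =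
      if EdgePattern t' then 1 else 0 := by
    clear h1
    revert t'
    decide +kernel
  rw [h1, h.countP_eq, List.countP_flatten, List.map_replicate, List.sum_replicate, h2]
  split_ifs <;> simp

theorem patternCount_eq_length {k : ℕ} {P : Pole V (Fin k) (Fin 4 ⊕ Fin 0)} {cs : List (List ℕ)}
    (hP : P.Describes cs) (t' : Fin 0 → Fin 3) :
    P.patternCount t' = (cs.foldl extend edgePatterns).length := by
  rw [patternCount, hP.sum_count]
  congr 1
  refine List.filter_eq_self.2 fun l _ => ?_
  simp

/-! ### Concrete edge-like poles and sockets of multiplicity 2, 5, 7 and 9 -/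

/-- A single edge, with two dangling edges at either end. -/
def edge : Pole (Fin 2) (Fin 1) (Fin 4) where
  src := ![0]
  dst := ![1]
  ter := ![0, 0, 1, 1]

theorem edge_edgeLike : edge.EdgeLike 1 where
  girth := GirthFiveCheck.girthFive (nb := ![[1], [0]]) (by decide +kernel)
  paired := by unfold Paired; decide
  degree := by decide +kernel
  cuts := by
    refine ⟨?_, ?_, ?_⟩
    · decide +kernel
    · decide +kernel
    · unfold Two
      decide +kernel
  count := by
    have h : ∀ t, Fintype.card {f : Fin 1 → Fin 3 // edge.Proper f t} =
        if EdgePattern t then 1 else 0 := by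
      decide +kernel
    intro t
    rw [count, Nat.card_eq_fintype_card, ← h]

/-- The Petersen graph without two adjacent vertices and two further edges. -/
def petersenTwo : Pole (Fin 8) (Fin 8) (Fin 4 ⊕ Fin 4) where
  src := ![2, 3, 4, 3, 6, 0, 0, 1]
  dst := ![3, 4, 5, 7, 7, 7, 1, 5]
  ter := Sum.elim ![2, 6, 0, 4] ![2, 1, 5, 6]

/-- The pairs given to `completedCuts` are the two cut edges put back; the lists after them describe
the whole Petersen graph vertex by vertex. The larger sockets follow the same scheme. -/
theorem petersenTwo_socket :
    petersenTwo.Socket fun Y => closingCut (Y ∘ petersenTwo.ter ∘ Sum.inr) where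
  girth := GirthFiveCheck.girthFive
    (nb := ![[1, 7], [0, 5], [3], [2, 4, 7], [3, 5], [1, 4], [7], [0, 3, 6]])
    (by decide +kernel)
  spread := by decide +kernel
  degree := by decide +kernel
  cuts := completedCuts [(2, 1), (5, 6)]
    [[], [0], [0], [0], [0, 3], [0], [0, 4], [0, 3], [0, 7], [0, 3, 6]]
    (by decide) rfl rfl (by decide +kernel) (by decide +kernel)

theorem petersenTwo_describes :
    petersenTwo.Describes [[3], [1, 0], [2, 0], [2, 1], [6, 0], [6, 1, 0], [7, 0], [4, 0], [11, 7],
      [2, 1], [7, 2], [13, 6]] :=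
  by decide +kernel

theorem EdgeLike.glue_petersenTwo {V E : Type} [Fintype V] [Fintype E] [DecidableEq V]
    {D : Pole V E (Fin 4)} {m : ℕ} (hD : D.EdgeLike m) : (D.glue petersenTwo).EdgeLike (m * 2) :=
  hD.glue petersenTwo_socket (by decide)
    (patternCount_of_perm petersenTwo_describes (by decide +kernel))

/-- A Blanuša snark without two adjacent vertices and two further edges. -/
def blanusaFive : Pole (Fin 16) (Fin 20) (Fin 4 ⊕ Fin 4) where
  src := ![6, 7, 5, 6, 3, 2, 1, 3, 0, 4, 12, 13, 9, 14, 8, 8, 9, 11, 10, 1]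
  dst := ![7, 8, 6, 14, 5, 3, 2, 4, 4, 12, 13, 14, 13, 15, 9, 15, 10, 15, 11, 10]
  ter := Sum.elim ![7, 2, 0, 5] ![12, 11, 1, 0]

theorem blanusaFive_socket :
    blanusaFive.Socket fun Y => closingCut (Y ∘ blanusaFive.ter ∘ Sum.inr) where
  girth := GirthFiveCheck.girthFive
    (nb := ![[4], [2, 10], [1, 3], [2, 4, 5], [0, 3, 12], [3, 6], [5, 7, 14], [6, 8], [7, 9, 15],
      [8, 10, 13], [1, 9, 11], [10, 15], [4, 13], [9, 12, 14], [6, 13, 15], [8, 11, 14]])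
    (by decide +kernel)
  spread := by decide +kernel
  degree := by decide +kernel
  cuts := completedCuts [(12, 11), (1, 0)]
    [[], [0], [0], [0], [0, 3], [0], [0, 3], [1, 5], [0], [0, 8], [0], [0], [0, 8], [0], [0, 7],
      [0, 3], [0, 7], [0, 3, 6]]
    (by decide) rfl rfl (by decide +kernel) (by decide +kernel)

theorem blanusaFive_describes :
    blanusaFive.Describes [[3], [4, 0], [2, 1], [2, 0], [4, 1], [7, 0], [8, 0], [2, 1], [9, 0], [1,
      0], [0], [7, 0], [1, 0], [9, 1], [12, 1], [13, 1, 0], [3, 1], [3, 1], [1, 0], [12, 2, 0],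
      [10, 9], [3, 2], [15, 2], [24, 14]] :=
  by decide +kernel

theorem EdgeLike.glue_blanusaFive {V E : Type} [Fintype V] [Fintype E] [DecidableEq V]
    {D : Pole V E (Fin 4)} {m : ℕ} (hD : D.EdgeLike m) : (D.glue blanusaFive).EdgeLike (m * 5) :=
  hD.glue blanusaFive_socket (by decide)
    (patternCount_of_perm blanusaFive_describes (by decide +kernel))

/-- A Blanuša snark without two adjacent vertices and two further edges, in a second way. -/
def blanusaSeven : Pole (Fin 16) (Fin 20) (Fin 4 ⊕ Fin 4) where
  src := ![5, 4, 3, 2, 4, 6, 7, 9, 10, 8, 8, 11, 11, 14, 2, 1, 12, 0, 1, 13]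
  dst := ![10, 5, 4, 3, 6, 7, 8, 10, 11, 9, 15, 15, 12, 15, 12, 2, 13, 1, 14, 14]
  ter := Sum.elim ![7, 5, 0, 3] ![9, 13, 0, 6]

theorem blanusaSeven_socket :
    blanusaSeven.Socket fun Y => closingCut (Y ∘ blanusaSeven.ter ∘ Sum.inr) where
  girth := GirthFiveCheck.girthFive
    (nb := ![[1], [0, 2, 14], [1, 3, 12], [2, 4], [3, 5, 6], [4, 10], [4, 7], [6, 8], [7, 9, 15],
      [8, 10], [5, 9, 11], [10, 12, 15], [2, 11, 13], [12, 14], [1, 13, 15], [8, 11, 14]])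
    (by decide +kernel)
  spread := by decide +kernel
  degree := by decide +kernel
  cuts := completedCuts [(9, 13), (0, 6)]
    [[], [0], [0], [0], [0], [0, 3], [0], [0, 6], [1, 5], [0, 8], [0], [0], [0, 4], [0], [0, 9],
      [0, 3], [0, 12], [0, 3, 6]]
    (by decide) rfl rfl (by decide +kernel) (by decide +kernel)

theorem blanusaSeven_describes :
    blanusaSeven.Describes [[2], [3, 0], [2, 0], [3, 0], [2, 1], [8, 0], [9, 0], [6], [7, 0], [2,
      1], [3, 0], [2, 0], [3, 0], [2, 1], [10, 1], [11, 0], [3, 1], [18, 1], [4, 2, 0], [5, 2, 0],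
      [12, 10], [4, 1], [23, 4], [18, 17]] :=
  by decide +kernel

theorem EdgeLike.glue_blanusaSeven {V E : Type} [Fintype V] [Fintype E] [DecidableEq V]
    {D : Pole V E (Fin 4)} {m : ℕ} (hD : D.EdgeLike m) : (D.glue blanusaSeven).EdgeLike (m * 7) :=
  hD.glue blanusaSeven_socket (by decide)
    (patternCount_of_perm blanusaSeven_describes (by decide +kernel))

/-- The flower snark with 20 vertices without two adjacent vertices and two further edges. -/
def flowerNine : Pole (Fin 18) (Fin 23) (Fin 4 ⊕ Fin 4) where
  src := ![2, 3, 1, 0, 0, 1, 4, 4, 5, 7, 8, 7, 6, 6, 16, 15, 12, 11, 10, 12, 10, 14, 13]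
  dst := ![3, 4, 2, 1, 5, 8, 5, 11, 6, 8, 14, 9, 7, 16, 17, 16, 17, 12, 11, 13, 15, 15, 14]
  ter := Sum.elim ![3, 17, 0, 9] ![2, 13, 9, 10]

theorem flowerNine_socket :
    flowerNine.Socket fun Y => closingCut (Y ∘ flowerNine.ter ∘ Sum.inr) where
  girth := GirthFiveCheck.girthFive
    (nb := ![[1, 5], [0, 2, 8], [1, 3], [2, 4], [3, 5, 11], [0, 4, 6], [5, 7, 16], [6, 8, 9], [1,
      7, 14], [7], [11, 15], [4, 10, 12], [11, 13, 17], [12, 14], [8, 13, 15], [10, 14, 16], [6,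
      15, 17], [12, 16]])
    (by decide +kernel)
  spread := by decide +kernel
  degree := by decide +kernel
  cuts := completedCuts [(2, 13), (9, 10)]
    [[], [0], [0], [0], [0], [0, 4], [0], [0, 4], [0], [0], [0, 6], [1, 9], [0], [0, 6], [0], [0,
      10], [0, 5], [0, 4], [0, 9], [0, 4, 18]]
    (by decide) rfl rfl (by decide +kernel) (by decide +kernel)

theorem flowerNine_describes :
    flowerNine.Describes [[3], [4, 0], [1], [4, 0], [5, 0], [2, 1], [4, 1], [5, 0], [3, 1], [3],
      [4, 0], [11, 1], [3, 2, 0], [4, 0], [16, 0], [1, 0], [18, 1], [9, 0], [10, 0], [2, 1], [4,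
      1], [10, 5, 0], [11, 2, 0], [22, 20], [4, 1], [25, 13], [7, 5]] :=
  by decide +kernel

theorem EdgeLike.glue_flowerNine {V E : Type} [Fintype V] [Fintype E] [DecidableEq V]
    {D : Pole V E (Fin 4)} {m : ℕ} (hD : D.EdgeLike m) : (D.glue flowerNine).EdgeLike (m * 9) :=
  hD.glue flowerNine_socket (by decide)
    (patternCount_of_perm flowerNine_describes (by decide +kernel))

/-! ### Final sockets, with the edge to be subtracted -/

/-- The Petersen graph without two adjacent vertices. -/
def petersenEnd : Pole (Fin 8) (Fin 10) (Fin 4 ⊕ Fin 0) where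
  src := ![4, 3, 0, 6, 0, 2, 5, 1, 3, 1]
  dst := ![6, 4, 6, 7, 1, 7, 7, 2, 5, 3]
  ter := Sum.elim ![2, 4, 0, 5] ![]

/-- The pole `petersenEnd` after subtraction of the edge between its last two vertices. -/
def petersenEndSubtracted : Pole (Fin 6) (Fin 7) (Fin 4 ⊕ Fin 0) where
  src := ![0, 3, 0, 1, 1, 3, 2]
  dst := ![4, 4, 1, 2, 3, 5, 5]
  ter := Sum.elim ![2, 4, 0, 5] ![]

theorem petersenEnd_socket : petersenEnd.Socket fun _ => 0 where
  girth := GirthFiveCheck.girthFive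
    (nb := ![[1, 6], [0, 2, 3], [1, 7], [1, 4, 5], [3, 6], [3, 7], [0, 4, 7], [2, 5, 6]])
    (by decide +kernel)
  spread := by decide +kernel
  degree := by decide +kernel
  cuts := completedCuts []
    [[], [0], [0], [0], [0, 3], [1], [0, 5], [1, 5], [1, 5], [0, 1, 4]]
    (by decide) rfl rfl (by decide +kernel) (by decide +kernel)

theorem petersenEnd_subtracts :
    petersenEnd.Subtracts petersenEndSubtracted (Fin.castLE (by decide : 6 ≤ 8)) 6 7 where
  inj := Fin.castLE_injective _
  ne_left := by decide
  ne_right := by decide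
  cover := by decide
  adj := by decide
  ter := by decide
  adj_iff := by decide +kernel

theorem petersenEnd_describes :
    petersenEnd.Describes [[2], [3, 0], [3, 1], [2, 0], [5, 1], [8, 1], [6, 2, 0], [10, 2, 1], [8,
      6, 1], [7, 4, 1, 0]] :=
  by decide +kernel

theorem petersenEndSubtracted_describes :
    petersenEndSubtracted.Describes [[2, 1], [3, 0], [3, 1], [6, 0], [2, 1, 0], [5, 3, 0], [9, 6,
      2, 0]] :=
  by decide +kernel

theorem EdgeLike.exists_isSnark_mul_1 {V E : Type} [Fintype V] [Fintype E] [DecidableEq V]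
    {D : Pole V E (Fin 4)} {m : ℕ} (hD : D.EdgeLike m) :
    ∃ (V : Type) (G : SimpleGraph V) (e : Sym2 V), IsSnark G ∧ e ∈ G.edgeSet ∧
      numColourings G e = 18 * (m * 1) := by
  refine hD.exists_isSnark petersenEnd_socket petersenEnd_subtracts (fun t' => ?_)
    ⟨by decide, by decide, by decide⟩ (fun t' => ?_)
  · rw [patternCount_eq_length petersenEnd_describes]
    decide +kernel
  · rw [patternCount_eq_length petersenEndSubtracted_describes]
    decide +kernel

/-- A Blanuša snark without two adjacent vertices. -/
def blanusaEnd : Pole (Fin 16) (Fin 22) (Fin 4 ⊕ Fin 0) where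
  src := ![4, 3, 2, 3, 1, 1, 0, 14, 0, 5, 6, 5, 9, 8, 10, 10, 13, 7, 7, 11, 12, 8]
  dst := ![14, 4, 3, 5, 2, 14, 1, 15, 9, 6, 7, 12, 10, 9, 15, 11, 15, 8, 11, 12, 13, 13]
  ter := Sum.elim ![6, 2, 0, 4] ![]

/-- The pole `blanusaEnd` after subtraction of the edge between its last two vertices. -/
def blanusaEndSubtracted : Pole (Fin 14) (Fin 19) (Fin 4 ⊕ Fin 0) where
  src := ![5, 6, 3, 5, 2, 3, 1, 1, 0, 0, 9, 8, 7, 7, 8, 10, 11, 12, 10]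
  dst := ![6, 7, 5, 12, 3, 4, 2, 4, 1, 9, 10, 9, 8, 11, 13, 11, 12, 13, 13]
  ter := Sum.elim ![6, 2, 0, 4] ![]

theorem blanusaEnd_socket : blanusaEnd.Socket fun _ => 0 where
  girth := GirthFiveCheck.girthFive
    (nb := ![[1, 9], [0, 2, 14], [1, 3], [2, 4, 5], [3, 14], [3, 6, 12], [5, 7], [6, 8, 11], [7, 9,
      13], [0, 8, 10], [9, 11, 15], [7, 10, 12], [5, 11, 13], [8, 12, 15], [1, 4, 15], [10, 13,
      14]])
    (by decide +kernel)
  spread := by decide +kernel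
  degree := by decide +kernel
  cuts := completedCuts []
    [[], [0], [0], [0], [0, 3], [0], [0, 4], [1], [0, 7], [0], [0], [0, 8], [0], [0, 3], [0, 6],
      [0, 4], [9, 12], [0, 1, 4]]
    (by decide) rfl rfl (by decide +kernel) (by decide +kernel)

theorem blanusaEnd_subtracts :
    blanusaEnd.Subtracts blanusaEndSubtracted (Fin.castLE (by decide : 14 ≤ 16)) 14 15 where
  inj := Fin.castLE_injective _
  ne_left := by decide
  ne_right := by decide
  cover := by decide
  adj := by decide
  ter := by decide
  adj_iff := by decide +kernel

theorem blanusaEnd_describes :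
    blanusaEnd.Describes [[0], [1, 0], [4, 0], [1, 0], [6, 1], [4, 0], [7, 1, 0], [6, 1], [9, 1],
      [12, 5], [13, 0], [7, 1], [3], [4, 0], [6, 1], [2, 0], [8, 1], [6, 3], [7, 2, 0], [7, 3, 0],
      [8, 3, 0], [7, 4, 3, 0]] :=
  by decide +kernel

theorem blanusaEndSubtracted_describes :
    blanusaEndSubtracted.Describes [[3], [4, 0], [1], [2, 0], [6, 1], [5, 2, 0], [8, 1], [7, 1, 0],
      [9, 1, 0], [10, 0], [0], [1, 0], [10, 0], [11, 0], [2, 1], [4, 1], [12, 2, 0], [13, 2, 0],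
      [7, 3, 2, 0]] :=
  by decide +kernel

theorem EdgeLike.exists_isSnark_mul_3 {V E : Type} [Fintype V] [Fintype E] [DecidableEq V]
    {D : Pole V E (Fin 4)} {m : ℕ} (hD : D.EdgeLike m) :
    ∃ (V : Type) (G : SimpleGraph V) (e : Sym2 V), IsSnark G ∧ e ∈ G.edgeSet ∧
      numColourings G e = 18 * (m * 3) := by
  refine hD.exists_isSnark blanusaEnd_socket blanusaEnd_subtracts (fun t' => ?_)
    ⟨by decide, by decide, by decide⟩ (fun t' => ?_)
  · rw [patternCount_eq_length blanusaEnd_describes]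
    decide +kernel
  · rw [patternCount_eq_length blanusaEndSubtracted_describes]
    decide +kernel

/-! ### Assembly -/

/-- There is an edge-like pole of multiplicity `m`. -/
def Realizable (m : ℕ) : Prop :=
  ∃ (V E : Type) (_ : Fintype V) (_ : Fintype E) (_ : DecidableEq V) (D : Pole V E (Fin 4)),
    D.EdgeLike m

theorem Realizable.mul_pow {P : ℕ} (h : ∀ m, Realizable m → Realizable (m * P)) {m : ℕ}
    (hm : Realizable m) (i : ℕ) : Realizable (m * P ^ i) := by
  induction i with
  | zero => simpa using hm
  | succ i ih =>
    rw [pow_succ, ← mul_assoc]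
    exact h _ ih

theorem realizable (i j k l : ℕ) : Realizable (2 ^ i * 9 ^ j * 5 ^ k * 7 ^ l) := by
  have h1 : Realizable 1 := ⟨_, _, _, _, _, _, edge_edgeLike⟩
  have h2 : Realizable (1 * 2 ^ i) := h1.mul_pow
    (fun _ ⟨_, _, _, _, _, _, h⟩ => ⟨_, _, _, _, _, _, h.glue_petersenTwo⟩) i
  have h3 := h2.mul_pow
    (fun _ ⟨_, _, _, _, _, _, h⟩ => ⟨_, _, _, _, _, _, h.glue_flowerNine⟩) j
  have h4 := h3.mul_pow
    (fun _ ⟨_, _, _, _, _, _, h⟩ => ⟨_, _, _, _, _, _, h.glue_blanusaFive⟩) k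
  have h5 := h4.mul_pow
    (fun _ ⟨_, _, _, _, _, _, h⟩ => ⟨_, _, _, _, _, _, h.glue_blanusaSeven⟩) l
  rwa [one_mul] at h5

end Pole

theorem corollary5p6 (i j k l : ℕ) :
    ∃ (V : Type) (G : SimpleGraph V) (e : Sym2 V),
      IsSnark G ∧ e ∈ G.edgeSet ∧
        numColourings G e = 18 * psi G e ∧ psi G e = 2 ^ i * 3 ^ j * 5 ^ k * 7 ^ l := by
  obtain ⟨V, G, e, hG, he, h⟩ : ∃ (V : Type) (G : SimpleGraph V) (e : Sym2 V), IsSnark G ∧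
      e ∈ G.edgeSet ∧ numColourings G e = 18 * (2 ^ i * 3 ^ j * 5 ^ k * 7 ^ l) := by
    -- Edge-like poles supply 3 only through powers of 9; an odd exponent takes its last factor 3
    -- from the Blanuša end.
    obtain ⟨a, rfl | rfl⟩ := j.even_or_odd'
    · obtain ⟨_, _, _, _, _, _, hD⟩ := Pole.realizable i a k l
      have := hD.exists_isSnark_mul_1
      rwa [mul_one, show (9 : ℕ) = 3 ^ 2 by rfl, ← pow_mul] at this
    · obtain ⟨_, _, _, _, _, _, hD⟩ := Pole.realizable i a k l
      have := hD.exists_isSnark_mul_3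
      rwa [show 2 ^ i * 9 ^ a * 5 ^ k * 7 ^ l * 3 = 2 ^ i * 3 ^ (2 * a + 1) * 5 ^ k * 7 ^ l by
        rw [show (9 : ℕ) = 3 ^ 2 by rfl, ← pow_mul]; ring] at this
  refine ⟨V, G, e, hG, he, ?_, ?_⟩ <;> simp [psi, h]
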